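/- Let $a,b\in\mathbf R\setminus\{1\}$ with $a\neq b$, suppose that $$\frac{5a+11b-16}{16ab-11a-5b}<0,$$ and let $\sigma\in \mathrm i\mathbf R$ satisfy $\sigma^2=\dfrac{5a+11b-16}{16ab-11a-5b}$. On $\Sigma=\overline{\mathbf C}\setminus\{0,\pm \mathrm i,\infty\}$ put $$g(z)=\sigma\,\frac{(b-a)z^4+4a(b-1)z^2+4a(b-1)}{(b-a)z^4+4(b-1)z^2+4(b-1)},\qquad h\,dz=\frac{\{(b-a)z^4+4(b-1)z^2+4(b-1)\}^2}{z^2(z^2+1)^2}\,dz .$$ Then there is, uniquely up to translation, a minimal surface (conformal minimal immersion) $X=(x^1,x^2,x^3)\colon\Sigma\to\mathbf R^3$ with Weierstrass data $(g,h\,dz)$, that is, with $\phi_i=\partial x^i\,dz$ one has $h\,dz=\phi_1-\mathrm i\phi_2$ and $g=\phi_3/(\phi_1-\mathrm i\phi_2)$. This surface is complete (every divergent path has infinite length), has finite total curvature, and its total curvature $\int_\Sigma K\,dA$ equals $-16\pi$. The composition of its Gauss map with the stereographic projection onto $\overline{\mathbf C}$ is $g$. The map $g\colon\Sigma\to\overline{\mathbf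 C}$ omits exactly two values, $\sigma$ and $\sigma a$, and has exactly one further totally ramified value, $\sigma b$, which has order $2$. (A value $\alpha$ is totally ramified if all roots of $g=\alpha$ in $\Sigma$ have multiplicity at least $2$; its order $\nu$ is the least multiplicity of a root, $\nu=\infty$ if $\alpha$ is omitted, and its weight is $1-1/\nu$.) Hence the total weight of the totally ramified values of $g$ is $\nu_g=1+1+(1-\tfrac12)=\tfrac52$. Moreover, the surface is distinct from the Miyaoka–Sato surfaces, i.e. from all minimal surfaces $Y\colon\overline{\mathbf C}\setminus\{\pm \mathrm i,\infty\}\to\mathbf R^3$ with Weierstrass data $$\left(\sigma'\,\frac{z^2+1+a'(t-1)}{z^2+t},\ \frac{(z^2+t)^2}{(z^2+1)^2}\,dz\right),\qquad a',t\in\mathbf R\setminus\{1\},\quad \sigma'^2=\frac{t+3}{a'\{(t-1)a'+4\}}<0:$$ it does not agree with any of them up to a reparametrization (homeomorphism of the domains) and a similarity of $\mathbf R^3$. -/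

import Mathlib

noncomputable section

namespace MinimalSurface

open scoped ContDiff

/-- Euclidean 3-space. -/
abbrev E3 : Type := EuclideanSpace ℝ (Fin 3)

/-! Surfaces are maps `X` into Euclidean 3-space, considered on an open set `Ω` of the complex plane
with its coordinate `z = u + i v`. -/

/-- The partial derivative `∂X/∂u`. -/
def Xu (X : ℂ → E3) (z : ℂ) : E3 := fderiv ℝ X z 1

/-- The partial derivative `∂X/∂v`. -/
def Xv (X : ℂ → E3) (z : ℂ) : E3 := fderiv ℝ X z Complex.I

/-- Coefficients `E, F, G` of the first fundamental form `E du² + 2 F du dv + G dv²`. -/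
def coeffE (X : ℂ → E3) (z : ℂ) : ℝ := inner ℝ (Xu X z) (Xu X z)

def coeffF (X : ℂ → E3) (z : ℂ) : ℝ := inner ℝ (Xu X z) (Xv X z)

def coeffG (X : ℂ → E3) (z : ℂ) : ℝ := inner ℝ (Xv X z) (Xv X z)

/-- The cross product of Euclidean 3-space. -/
def cross (v w : E3) : E3 := WithLp.toLp 2 (crossProduct (WithLp.ofLp v) (WithLp.ofLp w))

/-- The unit normal `n = (X_u × X_v) / |X_u × X_v|`. -/
def unitNormal (X : ℂ → E3) (z : ℂ) : E3 :=
  ‖cross (Xu X z) (Xv X z)‖⁻¹ • cross (Xu X z) (Xv X z)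

/-- Coefficients `L, M, N` of the second fundamental form. -/
def coeffL (X : ℂ → E3) (z : ℂ) : ℝ := inner ℝ (fderiv ℝ (Xu X) z 1) (unitNormal X z)

def coeffM (X : ℂ → E3) (z : ℂ) : ℝ := inner ℝ (fderiv ℝ (Xu X) z Complex.I) (unitNormal X z)

def coeffN (X : ℂ → E3) (z : ℂ) : ℝ := inner ℝ (fderiv ℝ (Xv X) z Complex.I) (unitNormal X z)

/-- The determinant `EG - F²` of the first fundamental form. -/
def metricDet (X : ℂ → E3) (z : ℂ) : ℝ := coeffE X z * coeffG X z - coeffF X z ^ 2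

/-- The mean curvature. -/
def meanCurvature (X : ℂ → E3) (z : ℂ) : ℝ :=
  (coeffE X z * coeffN X z - 2 * coeffF X z * coeffM X z + coeffG X z * coeffL X z) /
    (2 * metricDet X z)

/-- The Gauss curvature. -/
def gaussCurvature (X : ℂ → E3) (z : ℂ) : ℝ :=
  (coeffL X z * coeffN X z - coeffM X z ^ 2) / metricDet X z

/-- `X` restricted to `Ω` is a smooth conformal immersion with vanishing mean curvature, i.e. a
minimal surface for which `z = u + i v` is an isothermal coordinate. -/
structure IsMinimalSurface (X : ℂ → E3) (Ω : Set ℂ) : Prop where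
  smooth : ContDiffOn ℝ ∞ X Ω
  immersion : ∀ z ∈ Ω, Function.Injective (fderiv ℝ X z)
  conformal : ∀ z ∈ Ω, coeffE X z = coeffG X z ∧ coeffF X z = 0
  minimal : ∀ z ∈ Ω, meanCurvature X z = 0

/-- The density `K dA / (du dv)`. -/
def curvatureDensity (X : ℂ → E3) (z : ℂ) : ℝ := gaussCurvature X z * Real.sqrt (metricDet X z)

/-- The curvature `K` is integrable over the surface with respect to the area element. -/
def HasFiniteTotalCurvature (X : ℂ → E3) (Ω : Set ℂ) : Prop :=
  MeasureTheory.IntegrableOn (curvatureDensity X) Ω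

/-- The total curvature `∫ K dA`. -/
def totalCurvature (X : ℂ → E3) (Ω : Set ℂ) : ℝ := ∫ z in Ω, curvatureDensity X z

/-- Piecewise `C¹` paths `[0, ∞) → ℂ`. -/
def IsPiecewiseC1 (γ : ℝ → ℂ) : Prop :=
  ∃ t : ℕ → ℝ, t 0 = 0 ∧ StrictMono t ∧ Filter.Tendsto t Filter.atTop Filter.atTop ∧
    ∀ n, ContDiffOn ℝ 1 γ (Set.Icc (t n) (t (n + 1)))

/-- Divergent paths `[0, ∞) → Ω`: they eventually leave every compact subset of `Ω`. -/
structure IsDivergentPath (γ : ℝ → ℂ) (Ω : Set ℂ) : Prop where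
  piecewise : IsPiecewiseC1 γ
  mem : ∀ s, 0 ≤ s → γ s ∈ Ω
  diverges : ∀ K : Set ℂ, K ⊆ Ω → IsCompact K → ∀ᶠ s in Filter.atTop, γ s ∉ K

/-- The length of the path `γ` in the metric induced by `X`. -/
def pathLength (X : ℂ → E3) (γ : ℝ → ℂ) : ENNReal :=
  ∫⁻ s in Set.Ici (0 : ℝ), ‖fderiv ℝ X (γ s) (deriv γ s)‖ₑ

/-- All divergent paths have infinite length. -/
def IsCompleteSurface (X : ℂ → E3) (Ω : Set ℂ) : Prop :=
  ∀ γ : ℝ → ℂ, IsDivergentPath γ Ω → pathLength X γ = ⊤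

/-- The coefficient `∂x^i = (∂x^i/∂u - i ∂x^i/∂v)/2` of the differential `φ_i = ∂x^i dz`. -/
def phi (X : ℂ → E3) (i : Fin 3) (z : ℂ) : ℂ :=
  (((Xu X z i : ℝ) : ℂ) - Complex.I * ((Xv X z i : ℝ) : ℂ)) / 2

/-- `(g, h dz)` is the Weierstrass data of `X` on `Ω`, that is `h dz = φ₁ - i φ₂` and
`g = φ₃ / (φ₁ - i φ₂)` as a meromorphic function, with poles exactly where `h` vanishes. -/
structure HasWeierstrassData (X : ℂ → E3) (Ω : Set ℂ) (g h : ℂ → ℂ) : Prop where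
  holomorphic : DifferentiableOn ℂ h Ω
  meromorphic : MeromorphicOn g Ω
  h_eq : ∀ z ∈ Ω, h z = phi X 0 z - Complex.I * phi X 1 z
  g_eq : ∀ z ∈ Ω, h z ≠ 0 → g z = phi X 2 z / h z
  g_pole : ∀ z ∈ Ω, h z = 0 → meromorphicOrderAt g z < 0

open Classical in
/-- The Gauss map: the unit normal followed by stereographic projection from the north pole onto the
Riemann sphere `ℂ ∪ {∞}`. -/
def gaussMap (X : ℂ → E3) (z : ℂ) : OnePoint ℂ :=
  if unitNormal X z 2 = 1 then OnePoint.infty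
  else (((((unitNormal X z 0 : ℝ) : ℂ) + Complex.I * ((unitNormal X z 1 : ℝ) : ℂ)) /
    (1 - ((unitNormal X z 2 : ℝ) : ℂ)) : ℂ) : OnePoint ℂ)

/-! Value distribution of meromorphic functions. -/

/-- The multiplicity with which the meromorphic function `f` takes the value `α ∈ ℂ ∪ {∞}` at `p`;
it is `0` if `f(p) ≠ α`. Values of the Lean function `f` at its poles play no role. -/
def valueMult (f : ℂ → ℂ) (α : OnePoint ℂ) (p : ℂ) : ℕ∞ :=
  match α with
  | none => (((-(meromorphicOrderAt f p).untop₀).toNat : ℕ) : ℕ∞)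
  | some c => WithTop.map Int.toNat (meromorphicOrderAt (fun z => f z - c) p)

/-- `f` takes the value `α` at `p`. -/
def TakesValueAt (f : ℂ → ℂ) (α : OnePoint ℂ) (p : ℂ) : Prop := valueMult f α p ≠ 0

/-- The values in `ℂ ∪ {∞}` that `f` never takes on `Ω`. -/
def omittedValues (f : ℂ → ℂ) (Ω : Set ℂ) : Set (OnePoint ℂ) :=
  {α | ∀ p ∈ Ω, ¬ TakesValueAt f α p}

/-- The largest `ν` such that `f = α` has no root of multiplicity less than `ν` on `Ω`
(it is `∞` for an omitted value). -/
def ramificationOrder (f : ℂ → ℂ) (Ω : Set ℂ) (α : OnePoint ℂ) : ℕ∞ :=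
  ⨅ p ∈ Ω, ⨅ _ : TakesValueAt f α p, valueMult f α p

/-- The totally ramified values, i.e. those of order at least `2` (omitted values included). -/
def totallyRamifiedValues (f : ℂ → ℂ) (Ω : Set ℂ) : Set (OnePoint ℂ) :=
  {α | 2 ≤ ramificationOrder f Ω α}

/-- The sum of the weights `1 - 1/ν` of all totally ramified values, with `1/∞ = 0`. -/
def totalWeight (f : ℂ → ℂ) (Ω : Set ℂ) : ENNReal :=
  ∑' α : totallyRamifiedValues f Ω, (1 - ((ramificationOrder f Ω α : ℕ∞) : ENNReal)⁻¹)

/-- The two surfaces `X` on `Ω` and `Y` on `Ω'` agree up to a reparametrization and a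
similarity of Euclidean 3-space. -/
def AreSimilar (X : ℂ → E3) (Ω : Set ℂ) (Y : ℂ → E3) (Ω' : Set ℂ) : Prop :=
  ∃ (ψ : Ω' ≃ₜ Ω) (A : E3 ≃ᵢ E3) (c : ℝ), 0 < c ∧ ∀ p : Ω', X (ψ p) = c • A (Y p)

/-! The data of the surfaces in question. -/

/-- The Riemann sphere without `0, i, -i, ∞`. -/
def domain : Set ℂ := {z | z ≠ 0 ∧ z ≠ Complex.I ∧ z ≠ -Complex.I}

def numer (a b : ℝ) (z : ℂ) : ℂ :=
  (b - a) * z ^ 4 + 4 * a * (b - 1) * z ^ 2 + 4 * a * (b - 1)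

def denom (a b : ℝ) (z : ℂ) : ℂ :=
  (b - a) * z ^ 4 + 4 * (b - 1) * z ^ 2 + 4 * (b - 1)

def gData (a b : ℝ) (σ : ℂ) (z : ℂ) : ℂ := σ * (numer a b z / denom a b z)

def hData (a b : ℝ) (z : ℂ) : ℂ := denom a b z ^ 2 / (z ^ 2 * (z ^ 2 + 1) ^ 2)

/-- The value of `σ²`. -/
def sigmaSq (a b : ℝ) : ℝ := (5 * a + 11 * b - 16) / (16 * a * b - 11 * a - 5 * b)

/-- The Riemann sphere without `i, -i, ∞`, on which the Miyaoka–Sato surfaces live. -/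
def domainMS : Set ℂ := {z | z ≠ Complex.I ∧ z ≠ -Complex.I}

def gMS (a t : ℝ) (σ : ℂ) (z : ℂ) : ℂ := σ * ((z ^ 2 + 1 + a * (t - 1)) / (z ^ 2 + t))

def hMS (t : ℝ) (z : ℂ) : ℂ := (z ^ 2 + t) ^ 2 / (z ^ 2 + 1) ^ 2

def sigmaSqMS (a t : ℝ) : ℝ := (t + 3) / (a * ((t - 1) * a + 4))

/-- `Y` is one of the Miyaoka–Sato surfaces. -/
def IsMiyaokaSato (Y : ℂ → E3) : Prop :=
  ∃ (a t : ℝ) (σ : ℂ), a ≠ 1 ∧ t ≠ 1 ∧ sigmaSqMS a t < 0 ∧ σ ^ 2 = ((sigmaSqMS a t : ℝ) : ℂ) ∧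
    IsMinimalSurface Y domainMS ∧ HasWeierstrassData Y domainMS (gMS a t σ) (hMS t)

end MinimalSurface

end

open MinimalSurface

/-! Put `P = √h` and `Q = g√h`; both are rational and single-valued on `domain`. The forms `(P² -
Q²)/2`, `i(P² + Q²)/2`, `PQ` make a null curve with metric `(|P|² + |Q|²)²|dz|²`, so `X = Re ∫ 2φ`
is a minimal immersion once `P`, `Q` have no common zero and the real periods vanish.

Periods: with `d = b - a` and `e = 4(b - 1)`, each coordinate form is `c(A z⁶/(z²+1)² + B z²/(z²+1)
+ C/z²) dz`, whose primitive is rational up to `-c(5A/2 - B) arctan z`. Its real part is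
single-valued as soon as `c(5A/2 - B)` is imaginary. This is automatic for two coordinates, as `σ`
is imaginary; for the first it says `5A/2 = B`, which is the prescribed value of `σ²`. Hence
`surface` is explicit and `isSpinorSurface_surface` yields minimality, data and Gauss map.
Uniqueness holds because data and conformality determine all three forms.

Completeness: `log ((1+|z|²)²/(|z||z²+1|))` is proper and its gradient is bounded by a multiple of
`|P|² + |Q|²`, so a path of finite length cannot diverge.

Curvature: `-K dA` is the spherical area pulled back by `g`. Almost everywhere `g` is a composite of
two squarings and two Möbius maps, so it covers the sphere four times and the integral is `-4 · 4π`.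

Values: `g = σc` means that a combination of `z⁴` and `z²+1` vanishes. Up to a nonzero constant it
is `z²+1` for `c = 1` and `z⁴` for `c = a`, neither with roots in the domain, and `(z²+2)²` for `c =
b`. Every other `c`, and `∞`, has a simple root.

Distinctness is topological: the domain has four ends, that of the Miyaoka–Sato surfaces three. -/

noncomputable section
namespace MinimalSurface
open scoped ContDiff

/-! ### Geometry of a surface given by a pair of spinors -/

/-- The real linear form `v ↦ Re (c v)` on `ℂ`. -/
def reMulCLM (c : ℂ) : ℂ →L[ℝ] ℝ := Complex.reCLM.comp (ContinuousLinearMap.mul ℝ ℂ c)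

@[simp] lemma reMulCLM_apply (c v : ℂ) : reMulCLM c v = (c * v).re := rfl

/-- The null curve with spinors `P, Q`. -/
def spinorPhi (P Q : ℂ → ℂ) (i : Fin 3) (z : ℂ) : ℂ :=
  ![(P z ^ 2 - Q z ^ 2) / 2, Complex.I * (P z ^ 2 + Q z ^ 2) / 2, P z * Q z] i

/-- `X` is given on `Ω` by the spinor form of the Weierstrass representation. -/
structure IsSpinorSurface (X : ℂ → E3) (Ω : Set ℂ) (P Q : ℂ → ℂ) : Prop where
  isOpen : IsOpen Ω
  left : DifferentiableOn ℂ P Ω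
  right : DifferentiableOn ℂ Q Ω
  ne_zero : ∀ z ∈ Ω, P z ≠ 0 ∨ Q z ≠ 0
  hasFDerivAt : ∀ z ∈ Ω, ∀ i, HasFDerivAt (fun w => X w i) (reMulCLM (2 * spinorPhi P Q i z)) z

/-- The conformal factor `|P|² + |Q|²`. -/
def spinorNorm (P Q : ℂ → ℂ) (z : ℂ) : ℝ := Complex.normSq (P z) + Complex.normSq (Q z)

/-- The Wronskian `P' Q - P Q'`. -/
def spinorWronskian (P Q : ℂ → ℂ) (z : ℂ) : ℂ := deriv P z * Q z - P z * deriv Q z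

/-- Assembling real linear forms into a map to Euclidean 3-space. -/
def formsToE3 (c : Fin 3 → ℂ) : ℂ →L[ℝ] E3 :=
  ((EuclideanSpace.equiv (Fin 3) ℝ).symm : (Fin 3 → ℝ) →L[ℝ] E3).comp
    (ContinuousLinearMap.pi fun i => reMulCLM (c i))

@[simp] lemma formsToE3_apply (c : Fin 3 → ℂ) (v : ℂ) (i : Fin 3) :
    formsToE3 c v i = (c i * v).re := rfl

lemma hasFDerivAt_formsToE3 {X : ℂ → E3} {c : Fin 3 → ℂ} {z : ℂ}
    (h : ∀ i, HasFDerivAt (fun w => X w i) (reMulCLM (c i)) z) :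
    HasFDerivAt X (formsToE3 c) z := by
  rw [← hasFDerivWithinAt_univ, hasFDerivWithinAt_euclidean]
  intro i
  rw [hasFDerivWithinAt_univ]
  exact h i

lemma hasFDerivAt_re_mul {f : ℂ → ℂ} {f' z : ℂ} (h : HasDerivAt f f' z) (c : ℂ) :
    HasFDerivAt (fun w => (c * f w).re) (reMulCLM (c * f')) z := by
  have h1 := (h.const_mul c).hasFDerivAt.restrictScalars ℝ
  have h2 := Complex.reCLM.hasFDerivAt.comp z h1
  refine h2.congr_fderiv ?_
  ext v
  simp
  ring

/-- The normal vector attached to a pair of spinors, up to normalization. -/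
def spinorNormal (P Q : ℂ → ℂ) (z : ℂ) : E3 :=
  !₂[2 * (Q z * (starRingEnd ℂ) (P z)).re, 2 * (Q z * (starRingEnd ℂ) (P z)).im,
    Complex.normSq (Q z) - Complex.normSq (P z)]

namespace IsSpinorSurface

variable {X : ℂ → E3} {Ω : Set ℂ} {P Q : ℂ → ℂ} {z : ℂ}

lemma hasFDerivAt_total (h : IsSpinorSurface X Ω P Q) (hz : z ∈ Ω) :
    HasFDerivAt X (formsToE3 fun i => 2 * spinorPhi P Q i z) z :=
  hasFDerivAt_formsToE3 (h.hasFDerivAt z hz)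

lemma fderiv_eq (h : IsSpinorSurface X Ω P Q) (hz : z ∈ Ω) :
    fderiv ℝ X z = formsToE3 fun i => 2 * spinorPhi P Q i z :=
  (h.hasFDerivAt_total hz).fderiv

lemma spinorNorm_pos (h : IsSpinorSurface X Ω P Q) (hz : z ∈ Ω) : 0 < spinorNorm P Q z := by
  unfold spinorNorm
  rcases h.ne_zero z hz with h1 | h1
  · have := Complex.normSq_pos.2 h1
    have := Complex.normSq_nonneg (Q z)
    linarith
  · have := Complex.normSq_pos.2 h1
    have := Complex.normSq_nonneg (P z)
    linarith

lemma Xu_apply (h : IsSpinorSurface X Ω P Q) (hz : z ∈ Ω) (i : Fin 3) :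
    Xu X z i = (2 * spinorPhi P Q i z).re := by
  rw [Xu, h.fderiv_eq hz, formsToE3_apply, mul_one]

lemma Xv_apply (h : IsSpinorSurface X Ω P Q) (hz : z ∈ Ω) (i : Fin 3) :
    Xv X z i = (2 * Complex.I * spinorPhi P Q i z).re := by
  rw [Xv, h.fderiv_eq hz, formsToE3_apply]
  ring_nf

/-- Since `∑ φᵢ² = 0`, the sum of the squares of `Re (2 φᵢ v)` is `2 ∑ |φᵢ|² |v|²`, and `2 ∑ |φᵢ|² =
(|P|² + |Q|²)²`. -/
lemma norm_fderiv_apply (h : IsSpinorSurface X Ω P Q) (hz : z ∈ Ω) (v : ℂ) :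
    ‖fderiv ℝ X z v‖ = spinorNorm P Q z * ‖v‖ := by
  have h0 := (h.spinorNorm_pos hz).le
  rw [← sq_eq_sq₀ (norm_nonneg _) (by positivity), EuclideanSpace.norm_sq_eq, mul_pow,
    ← Complex.normSq_eq_norm_sq, Fin.sum_univ_three, h.fderiv_eq hz]
  simp [spinorPhi, spinorNorm, Complex.normSq_apply, pow_two]
  ring

lemma coeffs (h : IsSpinorSurface X Ω P Q) (hz : z ∈ Ω) :
    coeffE X z = spinorNorm P Q z ^ 2 ∧ coeffG X z = spinorNorm P Q z ^ 2 ∧ coeffF X z = 0 := by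
  unfold coeffE coeffF coeffG
  simp only [PiLp.inner_apply, Fin.sum_univ_three, h.Xu_apply hz, h.Xv_apply hz,
    RCLike.inner_apply, conj_trivial]
  refine ⟨?_, ?_, ?_⟩ <;>
  · simp [spinorPhi, spinorNorm, Complex.normSq_apply, pow_two]
    ring

lemma metricDet_eq (h : IsSpinorSurface X Ω P Q) (hz : z ∈ Ω) :
    metricDet X z = spinorNorm P Q z ^ 4 := by
  obtain ⟨h1, h2, h3⟩ := h.coeffs hz
  rw [metricDet, h1, h2, h3]
  ring

lemma cross_eq (h : IsSpinorSurface X Ω P Q) (hz : z ∈ Ω) :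
    cross (Xu X z) (Xv X z) = spinorNorm P Q z • spinorNormal P Q z := by
  ext i
  unfold cross
  fin_cases i <;>
  · simp [cross_apply, h.Xu_apply hz, h.Xv_apply hz, spinorPhi, spinorNorm, spinorNormal,
      Complex.normSq_apply, pow_two]
    ring

lemma norm_spinorNormal (P Q : ℂ → ℂ) (z : ℂ) :
    ‖spinorNormal P Q z‖ = spinorNorm P Q z := by
  have h0 : 0 ≤ spinorNorm P Q z := add_nonneg (Complex.normSq_nonneg _) (Complex.normSq_nonneg _)
  rw [← sq_eq_sq₀ (norm_nonneg _) h0, EuclideanSpace.norm_sq_eq, Fin.sum_univ_three]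
  simp only [Real.norm_eq_abs, sq_abs]
  simp [spinorNorm, spinorNormal, Complex.normSq_apply, pow_two]
  ring

lemma unitNormal_eq (h : IsSpinorSurface X Ω P Q) (hz : z ∈ Ω) :
    unitNormal X z = (spinorNorm P Q z)⁻¹ • spinorNormal P Q z := by
  have h0 := h.spinorNorm_pos hz
  rw [unitNormal, h.cross_eq hz, norm_smul, norm_spinorNormal, smul_smul, Real.norm_of_nonneg h0.le]
  congr 1
  field_simp

lemma hasDerivAt_spinorPhi (h : IsSpinorSurface X Ω P Q) (hz : z ∈ Ω) (i : Fin 3) :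
    HasDerivAt (spinorPhi P Q i)
      (![P z * deriv P z - Q z * deriv Q z, Complex.I * (P z * deriv P z + Q z * deriv Q z),
        deriv P z * Q z + P z * deriv Q z] i) z := by
  have hP := (h.left.differentiableAt (h.isOpen.mem_nhds hz)).hasDerivAt
  have hQ := (h.right.differentiableAt (h.isOpen.mem_nhds hz)).hasDerivAt
  fin_cases i
  · refine (((hP.pow 2).sub (hQ.pow 2)).div_const 2).congr_deriv ?_
    simp
    ring
  · refine ((((hP.pow 2).add (hQ.pow 2)).const_mul Complex.I).div_const 2).congr_deriv ?_
    simp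
    ring
  · exact hP.mul hQ

lemma fderiv_Xu (h : IsSpinorSurface X Ω P Q) (hz : z ∈ Ω) :
    fderiv ℝ (Xu X) z = formsToE3 fun i => 2 * deriv (spinorPhi P Q i) z := by
  apply HasFDerivAt.fderiv
  refine hasFDerivAt_formsToE3 fun i => ?_
  have h1 := hasFDerivAt_re_mul (h.hasDerivAt_spinorPhi hz i).differentiableAt.hasDerivAt 2
  refine h1.congr_of_eventuallyEq ?_
  filter_upwards [h.isOpen.mem_nhds hz] with w hw using h.Xu_apply hw i

lemma fderiv_Xv (h : IsSpinorSurface X Ω P Q) (hz : z ∈ Ω) :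
    fderiv ℝ (Xv X) z = formsToE3 fun i => 2 * Complex.I * deriv (spinorPhi P Q i) z := by
  apply HasFDerivAt.fderiv
  refine hasFDerivAt_formsToE3 fun i => ?_
  have h1 := hasFDerivAt_re_mul (h.hasDerivAt_spinorPhi hz i).differentiableAt.hasDerivAt
    (2 * Complex.I)
  refine h1.congr_of_eventuallyEq ?_
  filter_upwards [h.isOpen.mem_nhds hz] with w hw using h.Xv_apply hw i

/-- The second fundamental form is `Re (2 W dz²)` with `W` the Wronskian. It is therefore trace-free
for the conformal metric, which is the vanishing of the mean curvature, and its determinant is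
`-4|W|²`. -/
lemma second_coeffs (h : IsSpinorSurface X Ω P Q) (hz : z ∈ Ω) :
    coeffL X z = 2 * (spinorWronskian P Q z).re ∧ coeffM X z = -2 * (spinorWronskian P Q z).im ∧
      coeffN X z = -2 * (spinorWronskian P Q z).re := by
  have h0 := (h.spinorNorm_pos hz).ne'
  unfold coeffL coeffM coeffN
  simp only [PiLp.inner_apply, Fin.sum_univ_three, h.fderiv_Xu hz, h.fderiv_Xv hz,
    h.unitNormal_eq hz, formsToE3_apply, (h.hasDerivAt_spinorPhi hz _).deriv, PiLp.smul_apply,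
    smul_eq_mul]
  refine ⟨?_, ?_, ?_⟩ <;>
  · simp only [spinorNormal, spinorWronskian]
    simp
    field_simp
    simp [spinorNorm, Complex.normSq_apply]
    ring

lemma meanCurvature_eq_zero (h : IsSpinorSurface X Ω P Q) (hz : z ∈ Ω) :
    meanCurvature X z = 0 := by
  obtain ⟨h1, h2, h3⟩ := h.coeffs hz
  obtain ⟨h4, h5, h6⟩ := h.second_coeffs hz
  rw [meanCurvature, h1, h2, h3, h4, h5, h6]
  ring

lemma curvatureDensity_eq (h : IsSpinorSurface X Ω P Q) (hz : z ∈ Ω) :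
    curvatureDensity X z =
      -(4 * Complex.normSq (spinorWronskian P Q z) / spinorNorm P Q z ^ 2) := by
  obtain ⟨h4, h5, h6⟩ := h.second_coeffs hz
  have h0 := h.spinorNorm_pos hz
  have h7 : Real.sqrt (spinorNorm P Q z ^ 4) = spinorNorm P Q z ^ 2 := by
    rw [show spinorNorm P Q z ^ 4 = (spinorNorm P Q z ^ 2) ^ 2 by ring]
    exact Real.sqrt_sq (by positivity)
  rw [curvatureDensity, gaussCurvature, h.metricDet_eq hz, h4, h5, h6, h7, Complex.normSq_apply]
  field_simp
  ring

lemma isMinimalSurface (h : IsSpinorSurface X Ω P Q) : IsMinimalSurface X Ω where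
  smooth := by
    rw [contDiffOn_euclidean]
    intro i
    rw [contDiffOn_infty_iff_fderiv_of_isOpen h.isOpen]
    refine ⟨fun z hz => (h.hasFDerivAt z hz i).differentiableAt.differentiableWithinAt, ?_⟩
    have h1 : ContDiffOn ℝ ∞ (fun z => reMulCLM (2 * spinorPhi P Q i z)) Ω := by
      have h2 : DifferentiableOn ℂ (spinorPhi P Q i) Ω := fun z hz =>
        (h.hasDerivAt_spinorPhi hz i).differentiableAt.differentiableWithinAt
      have h3 : ContDiffOn ℝ ∞ (fun z => 2 * spinorPhi P Q i z) Ω :=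
        ((h2.contDiffOn h.isOpen).restrict_scalars ℝ).const_smul (2 : ℂ)
      exact contDiffOn_const.clm_comp ((ContinuousLinearMap.mul ℝ ℂ).contDiff.comp_contDiffOn h3)
    exact h1.congr fun z hz => (h.hasFDerivAt z hz i).fderiv
  immersion := fun z hz => by
    rw [injective_iff_map_eq_zero]
    intro v hv
    have h1 := h.norm_fderiv_apply hz v
    rw [hv, norm_zero] at h1
    simpa [(h.spinorNorm_pos hz).ne'] using h1.symm
  conformal := fun z hz => by
    obtain ⟨h1, h2, h3⟩ := h.coeffs hz
    exact ⟨h1.trans h2.symm, h3⟩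
  minimal := fun z hz => h.meanCurvature_eq_zero hz

lemma phi_eq (h : IsSpinorSurface X Ω P Q) (hz : z ∈ Ω) (i : Fin 3) :
    phi X i z = spinorPhi P Q i z := by
  rw [phi, h.Xu_apply hz, h.Xv_apply hz]
  apply Complex.ext <;> simp

lemma phi_zero_sub (h : IsSpinorSurface X Ω P Q) (hz : z ∈ Ω) :
    phi X 0 z - Complex.I * phi X 1 z = P z ^ 2 := by
  rw [h.phi_eq hz, h.phi_eq hz]
  simp only [spinorPhi, Matrix.cons_val_zero, Matrix.cons_val_one]
  linear_combination (-(P z ^ 2 + Q z ^ 2) / 2) * Complex.I_sq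

lemma phi_two (h : IsSpinorSurface X Ω P Q) (hz : z ∈ Ω) : phi X 2 z = P z * Q z := by
  rw [h.phi_eq hz]
  rfl

lemma gaussMap_of_eq_zero (h : IsSpinorSurface X Ω P Q) (hz : z ∈ Ω) (hP : P z = 0) :
    gaussMap X z = OnePoint.infty := by
  have h0 := (h.spinorNorm_pos hz).ne'
  rw [gaussMap, if_pos]
  rw [h.unitNormal_eq hz, PiLp.smul_apply]
  simp only [spinorNorm, hP, map_zero, zero_add] at h0
  simp [spinorNormal, spinorNorm, hP, h0]

lemma gaussMap_of_ne_zero (h : IsSpinorSurface X Ω P Q) (hz : z ∈ Ω) (hP : P z ≠ 0) :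
    gaussMap X z = ((Q z / P z : ℂ) : OnePoint ℂ) := by
  have h0 := (h.spinorNorm_pos hz).ne'
  have h1 : Complex.normSq (P z) ≠ 0 := by simpa using hP
  have h2 : unitNormal X z 2 = 1 - 2 * Complex.normSq (P z) / spinorNorm P Q z := by
    rw [h.unitNormal_eq hz, PiLp.smul_apply]
    have h3 : spinorNormal P Q z 2 = spinorNorm P Q z - 2 * Complex.normSq (P z) := by
      simp [spinorNormal, spinorNorm]
      ring
    rw [h3, smul_eq_mul]
    field_simp
  have h3 : (((unitNormal X z 0 : ℝ) : ℂ) + Complex.I * ((unitNormal X z 1 : ℝ) : ℂ)) =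
      2 * (Q z * (starRingEnd ℂ) (P z)) / (spinorNorm P Q z : ℝ) := by
    rw [h.unitNormal_eq hz, PiLp.smul_apply, PiLp.smul_apply, div_eq_inv_mul, ← Complex.ofReal_inv]
    apply Complex.ext <;> simp [spinorNormal]
  rw [gaussMap, if_neg, h3, h2]
  · congr 1
    have h4 : ((spinorNorm P Q z : ℝ) : ℂ) ≠ 0 := by exact_mod_cast h0
    have h5 : (starRingEnd ℂ) (P z) ≠ 0 := by simpa using hP
    push_cast
    rw [Complex.normSq_eq_conj_mul_self]
    field_simp
    ring_nf
    field_simp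
  · rw [h2]
    intro h4
    have : 2 * Complex.normSq (P z) / spinorNorm P Q z = 0 := by linarith
    simp [h0, hP] at this

/-- Conformal surfaces with the Weierstrass data of a spinor surface are translates of it. -/
lemma eq_add_const (h : IsSpinorSurface X Ω P Q) (hΩ : IsPreconnected Ω)
    (hd : Ω ⊆ closure {z ∈ Ω | P z ≠ 0}) {X' : ℂ → E3} (hX' : IsMinimalSurface X' Ω)
    (h1 : ∀ z ∈ Ω, phi X' 0 z - Complex.I * phi X' 1 z = P z ^ 2)
    (h2 : ∀ z ∈ Ω, P z ≠ 0 → phi X' 2 z = P z * Q z) :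
    ∃ c : E3, ∀ z ∈ Ω, X' z = X z + c := by
  have key : ∀ z ∈ {z ∈ Ω | P z ≠ 0}, fderiv ℝ X' z = fderiv ℝ X z := by
    rintro z ⟨hz, hP⟩
    have e1 := h1 z hz
    have e2 := h2 z hz hP
    -- Conformality in complex form: `4 ∑ φᵢ² = E - G - 2iF`.
    have e3 : phi X' 0 z ^ 2 + phi X' 1 z ^ 2 + phi X' 2 z ^ 2 = 0 := by
      obtain ⟨c1, c2⟩ := hX'.conformal z hz
      simp only [coeffE, coeffF, coeffG, PiLp.inner_apply, Fin.sum_univ_three,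
        RCLike.inner_apply, conj_trivial] at c1 c2
      apply Complex.ext
      · simp [phi, pow_two]
        linarith
      · simp [phi, pow_two]
        linarith
    -- The product `(φ₁ - iφ₂)(φ₁ + iφ₂)` equals `-φ₃² = -P²Q²`, and the first factor is `P² ≠ 0`.
    -- So the Weierstrass data determine the remaining combination.
    have e4 : phi X' 0 z + Complex.I * phi X' 1 z = -Q z ^ 2 := by
      have hP2 : P z ^ 2 ≠ 0 := pow_ne_zero _ hP
      apply mul_left_cancel₀ hP2
      rw [← e1]
      rw [e2] at e3
      linear_combination e3 - (phi X' 1 z) ^ 2 * Complex.I_sq + Q z ^ 2 * e1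
    have e5 : ∀ i, phi X' i z = phi X i z := by
      intro i
      rw [h.phi_eq hz]
      fin_cases i
      · simp only [spinorPhi]
        simp
        linear_combination (e1 + e4) / 2
      · simp only [spinorPhi]
        simp
        linear_combination (Complex.I / 2) * e1 - (Complex.I / 2) * e4 +
          phi X' 1 z * Complex.I_sq
      · exact e2
    have e6 : ∀ i, Xu X' z i = Xu X z i ∧ Xv X' z i = Xv X z i := by
      intro i
      have := e5 i
      have r := congrArg Complex.re this
      have s := congrArg Complex.im this
      simp [phi] at r s
      constructor <;> linarith
    ext v i
    have hv : v = v.re • (1 : ℂ) + v.im • Complex.I := by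
      apply Complex.ext <;> simp
    rw [hv]
    simp only [map_add, map_smul]
    have := e6 i
    simp only [Xu, Xv] at this
    simp [this.1, this.2]
  -- At zeros of `P` the data say nothing directly about `φ₃`; continuity of the differentials
  -- carries the equality over from the dense set where `P ≠ 0`.
  have key2 : Ω.EqOn (fderiv ℝ X') (fderiv ℝ X) := by
    have c1 : ContinuousOn (fderiv ℝ X') Ω :=
      hX'.smooth.continuousOn_fderiv_of_isOpen h.isOpen (by simp)
    have c2 : ContinuousOn (fderiv ℝ X) Ω :=
      h.isMinimalSurface.smooth.continuousOn_fderiv_of_isOpen h.isOpen (by simp)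
    exact Set.EqOn.of_subset_closure key c1 c2 (fun _ hz => hz.1) hd
  obtain ⟨c, hc⟩ := h.isOpen.exists_eq_add_of_fderiv_eq hΩ
    (hX'.smooth.differentiableOn (by simp)) (h.isMinimalSurface.smooth.differentiableOn (by simp))
    key2
  exact ⟨c, fun z hz => hc hz⟩

end IsSpinorSurface

end MinimalSurface
end

/-! ### The Weierstrass data, their periods and the explicit immersion -/

noncomputable section
namespace MinimalSurface
open scoped ContDiff

lemma sq_add_one_eq (z : ℂ) : z ^ 2 + 1 = (z - Complex.I) * (z + Complex.I) := by
  linear_combination Complex.I_sq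

lemma sq_add_one_ne_zero_iff (z : ℂ) : z ^ 2 + 1 ≠ 0 ↔ z ≠ Complex.I ∧ z ≠ -Complex.I := by
  rw [sq_add_one_eq, mul_ne_zero_iff, sub_ne_zero, ← sub_neg_eq_add, sub_ne_zero]

lemma mem_domain_iff (z : ℂ) : z ∈ domain ↔ z ≠ 0 ∧ z ^ 2 + 1 ≠ 0 := by
  rw [sq_add_one_ne_zero_iff]
  rfl

lemma domain_eq_compl : domain = ({0, Complex.I, -Complex.I} : Set ℂ)ᶜ := by
  ext z
  simp [domain]

lemma isOpen_domain : IsOpen domain := by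
  rw [domain_eq_compl]
  exact (Set.toFinite _).isClosed.isOpen_compl

lemma isPreconnected_domain : IsPreconnected domain := by
  rw [domain_eq_compl]
  exact ((Set.toFinite _).countable.isConnected_compl_of_one_lt_rank (by simp)).isPreconnected

/-- In the basis `z⁴`, `z² + 1`, squares and products divided by `z²(z²+1)²` split into three
elementary terms, and all `numer - c * denom` lie in one pencil. -/
lemma denom_eq (a b : ℝ) (z : ℂ) :
    denom a b z = (b - a) * z ^ 4 + 4 * (b - 1) * (z ^ 2 + 1) := by
  rw [denom]
  ring

lemma numer_eq (a b : ℝ) (z : ℂ) :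
    numer a b z = (b - a) * z ^ 4 + a * (4 * (b - 1)) * (z ^ 2 + 1) := by
  rw [numer]
  ring

/-- The square root of `h`. -/
def leftSpinor (a b : ℝ) (z : ℂ) : ℂ := denom a b z / (z * (z ^ 2 + 1))

/-- `g` times the square root of `h`. -/
def rightSpinor (a b : ℝ) (σ : ℂ) (z : ℂ) : ℂ := σ * numer a b z / (z * (z ^ 2 + 1))

lemma differentiable_denom (a b : ℝ) : Differentiable ℂ (denom a b) := by
  unfold denom
  fun_prop

lemma differentiable_numer (a b : ℝ) : Differentiable ℂ (numer a b) := by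
  unfold numer
  fun_prop

lemma differentiableOn_leftSpinor (a b : ℝ) : DifferentiableOn ℂ (leftSpinor a b) domain := by
  refine (differentiable_denom a b).differentiableOn.div (by fun_prop) fun z hz => ?_
  rw [mem_domain_iff] at hz
  exact mul_ne_zero hz.1 hz.2

lemma differentiableOn_rightSpinor (a b : ℝ) (σ : ℂ) :
    DifferentiableOn ℂ (rightSpinor a b σ) domain := by
  refine ((differentiable_numer a b).differentiableOn.const_mul σ).div (by fun_prop)
    fun z hz => ?_
  rw [mem_domain_iff] at hz
  exact mul_ne_zero hz.1 hz.2

lemma hData_eq (a b : ℝ) (z : ℂ) : hData a b z = leftSpinor a b z ^ 2 := by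
  rw [hData, leftSpinor, div_pow, mul_pow]

lemma gData_eq_div {z : ℂ} (hz : z ∈ domain) (a b : ℝ) (σ : ℂ) :
    gData a b σ z = rightSpinor a b σ z / leftSpinor a b z := by
  rw [mem_domain_iff] at hz
  have := mul_ne_zero hz.1 hz.2
  rw [gData, rightSpinor, leftSpinor, div_div_div_cancel_right₀ this, mul_div_assoc]

lemma hasFDerivAt_log_norm {f : ℂ → ℂ} {f' z : ℂ} (h : HasDerivAt f f' z) (hz : f z ≠ 0) :
    HasFDerivAt (fun w => Real.log ‖f w‖) (reMulCLM (f' / f z)) z := by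
  -- Dividing by the constant `f z` moves the value at `z` to `1`, away from the branch cut of the
  -- principal logarithm.
  have h1 : HasDerivAt (fun w => Complex.log (f w / f z)) (f' / f z) z := by
    have := (h.div_const (f z)).clog (by rw [div_self hz]; simp)
    simpa [div_self hz] using this
  have h2 := hasFDerivAt_re_mul h1 1
  rw [one_mul] at h2
  refine (h2.add_const (Real.log ‖f z‖)).congr_of_eventuallyEq ?_
  filter_upwards [h.continuousAt.eventually_ne hz] with w hw
  rw [one_mul, Complex.log_re, norm_div, Real.log_div (by simpa) (by simpa)]
  ring

/-- The real part of `i arctan z`, a single-valued function. -/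
def reArctan (z : ℂ) : ℝ := Real.log ‖1 + Complex.I * z‖ / 2 - Real.log ‖1 - Complex.I * z‖ / 2

lemma hasFDerivAt_reArctan {z : ℂ} (hz : z ^ 2 + 1 ≠ 0) :
    HasFDerivAt reArctan (reMulCLM (Complex.I / (z ^ 2 + 1))) z := by
  have e : z ^ 2 + 1 = (1 + Complex.I * z) * (1 - Complex.I * z) := by
    linear_combination z ^ 2 * Complex.I_sq
  rw [e, mul_ne_zero_iff] at hz
  obtain ⟨n1, n2⟩ := hz
  have d1 : HasDerivAt (fun w => 1 + Complex.I * w) (Complex.I * 1) z :=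
    ((hasDerivAt_id z).const_mul Complex.I).const_add 1
  have d2 : HasDerivAt (fun w => 1 - Complex.I * w) (-(Complex.I * 1)) z :=
    ((hasDerivAt_id z).const_mul Complex.I).const_sub 1
  have h := ((hasFDerivAt_log_norm d1 n1).mul_const (2⁻¹ : ℝ)).sub
    ((hasFDerivAt_log_norm d2 n2).mul_const (2⁻¹ : ℝ))
  refine h.congr_fderiv ?_
  ext v
  rw [e]
  have : Complex.I / ((1 + Complex.I * z) * (1 - Complex.I * z)) * v =
      ((2⁻¹ : ℝ) : ℂ) * (Complex.I * 1 / (1 + Complex.I * z) * v) -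
      ((2⁻¹ : ℝ) : ℂ) * (-(Complex.I * 1) / (1 - Complex.I * z) * v) := by
    push_cast
    field_simp
    ring
  rw [reMulCLM_apply, this, Complex.sub_re, Complex.re_ofReal_mul, Complex.re_ofReal_mul]
  rfl

/-- The rational part of the primitive of `A z⁶ / (z² + 1)² + B z² / (z² + 1) + C / z²`. -/
def rationalPrimitive (A B C z : ℂ) : ℂ :=
  A * (z ^ 3 / 3 - 2 * z - z / (2 * (z ^ 2 + 1))) + B * z - C * z⁻¹

/-- The last term, a multiple of the derivative of `arctan`, is what no rational primitive can
absorb: it carries the residues at `±i`. -/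
lemma hasDerivAt_rationalPrimitive (A B C : ℂ) {z : ℂ} (hz : z ∈ domain) :
    HasDerivAt (rationalPrimitive A B C)
      (A * (z ^ 6 / (z ^ 2 + 1) ^ 2) + B * (z ^ 2 / (z ^ 2 + 1)) + C / z ^ 2 -
        (5 / 2 * A - B) / (z ^ 2 + 1)) z := by
  rw [mem_domain_iff] at hz
  obtain ⟨h0, h1⟩ := hz
  have h2 : 2 * (z ^ 2 + 1) ≠ 0 := mul_ne_zero two_ne_zero h1
  have i := hasDerivAt_id z
  have d := ((((((i.pow 3).div_const 3).sub (i.const_mul 2)).sub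
    (i.div (((i.pow 2).add_const 1).const_mul 2) h2)).const_mul A).add (i.const_mul B)).sub
    ((hasDerivAt_inv h0).const_mul C)
  refine d.congr_deriv ?_
  simp
  field_simp
  ring

/-- `hκ` is the period condition: when `c(5A/2 - B)` is imaginary, only the single-valued `Re (i
arctan z)` is needed to complete the rational part. -/
lemma hasFDerivAt_primitive (A B C κ : ℝ) (c : ℂ) (hκ : c * (5 / 2 * A - B) = Complex.I * κ)
    {z : ℂ} (hz : z ∈ domain) :
    HasFDerivAt (fun w => (c * rationalPrimitive A B C w).re + κ * reArctan w)
      (reMulCLM (c * (A * (z ^ 6 / (z ^ 2 + 1) ^ 2) + B * (z ^ 2 / (z ^ 2 + 1)) + C / z ^ 2)))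
      z := by
  have h1 := (mem_domain_iff z).1 hz
  have d := (hasFDerivAt_re_mul (hasDerivAt_rationalPrimitive A B C hz) c).add
    ((hasFDerivAt_reArctan h1.2).const_mul κ)
  refine d.congr_fderiv ?_
  ext v
  simp only [_root_.add_apply, _root_.smul_apply, reMulCLM_apply,
    smul_eq_mul]
  rw [← Complex.re_ofReal_mul, ← Complex.add_re]
  congr 1
  linear_combination (-v / (z ^ 2 + 1)) * hκ

lemma eq_I_mul_im {σ : ℂ} {s : ℝ} (hs : s < 0) (hσ : σ ^ 2 = (s : ℂ)) :
    σ = Complex.I * (σ.im : ℂ) := by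
  have h1 := congrArg Complex.re hσ
  have h2 := congrArg Complex.im hσ
  simp [pow_two] at h1 h2
  have h3 : σ.re = 0 := by
    by_contra h
    have : σ.im = 0 := by
      have h4 : σ.re * σ.im = 0 := by linarith
      exact (mul_eq_zero.1 h4).resolve_left h
    rw [this] at h1
    nlinarith [sq_nonneg σ.re]
  apply Complex.ext <;> simp [h3]

/-- The immersion with the data `gData`, `hData`. -/
def surface (a b : ℝ) (σ : ℂ) (z : ℂ) : E3 :=
  let s := sigmaSq a b
  let d := b - a
  let e := 4 * (b - 1)
  let A := d ^ 2 * (1 + s)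
  let B := 2 * d * e * (1 + a * s)
  -- The factor `1` and the term with coefficient `0` put this coordinate into the shape of
  -- `hasFDerivAt_primitive`.
  !₂[(1 * rationalPrimitive (d ^ 2 * (1 - s) : ℝ) (2 * d * e * (1 - a * s) : ℝ)
        (e ^ 2 * (1 - a ^ 2 * s) : ℝ) z).re + (0 : ℝ) * reArctan z,
    (Complex.I * rationalPrimitive (A : ℝ) (B : ℝ) (e ^ 2 * (1 + a ^ 2 * s) : ℝ) z).re +
      (5 / 2 * A - B) * reArctan z,
    (2 * σ * rationalPrimitive (d ^ 2 : ℝ) (d * e * (1 + a) : ℝ) (a * e ^ 2 : ℝ) z).re +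
      2 * σ.im * (5 / 2 * d ^ 2 - d * e * (1 + a)) * reArctan z]

/-- The difference `denom - numer` is `4(b-1)(1-a)(z²+1)`, which has no zero on the domain. -/
lemma numer_denom_no_common_zero {a b : ℝ} (ha : a ≠ 1) (hb : b ≠ 1) {z : ℂ}
    (hz : z ∈ domain) (h1 : denom a b z = 0) (h2 : numer a b z = 0) : False := by
  rw [mem_domain_iff] at hz
  rw [denom_eq] at h1
  rw [numer_eq] at h2
  have h3 : ((b : ℂ) - 1) * (1 - a) * (z ^ 2 + 1) = 0 := by linear_combination (h1 - h2) / 4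
  have hb' : (b : ℂ) - 1 ≠ 0 := by exact_mod_cast sub_ne_zero.2 hb
  have ha' : 1 - (a : ℂ) ≠ 0 := by exact_mod_cast sub_ne_zero.2 ha.symm
  exact mul_ne_zero (mul_ne_zero hb' ha') hz.2 h3

lemma isSpinorSurface_surface {a b : ℝ} {σ : ℂ} (ha : a ≠ 1) (hb : b ≠ 1)
    (hneg : sigmaSq a b < 0) (hσ : σ ^ 2 = ((sigmaSq a b : ℝ) : ℂ)) :
    IsSpinorSurface (surface a b σ) domain (leftSpinor a b) (rightSpinor a b σ) where
  isOpen := isOpen_domain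
  left := differentiableOn_leftSpinor a b
  right := differentiableOn_rightSpinor a b σ
  ne_zero := fun z hz => by
    by_contra! h
    have hz' := (mem_domain_iff z).1 hz
    have hσ0 : σ ≠ 0 := by
      rintro rfl
      rw [zero_pow two_ne_zero] at hσ
      exact hneg.ne (by exact_mod_cast hσ.symm)
    have hzz := mul_ne_zero hz'.1 hz'.2
    obtain ⟨h1, h2⟩ := h
    rw [leftSpinor, div_eq_zero_iff, or_iff_left hzz] at h1
    rw [rightSpinor, div_eq_zero_iff, or_iff_left hzz, mul_eq_zero, or_iff_right hσ0] at h2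
    exact numer_denom_no_common_zero ha hb hz h1 h2
  hasFDerivAt := fun z hz i => by
    have hz' := (mem_domain_iff z).1 hz
    obtain ⟨h0, h1⟩ := hz'
    have hden : 16 * a * b - 11 * a - 5 * b ≠ 0 := by
      intro h
      rw [sigmaSq, h, div_zero] at hneg
      exact lt_irrefl _ hneg
    have hs : sigmaSq a b * (16 * a * b - 11 * a - 5 * b) = 5 * a + 11 * b - 16 :=
      div_mul_cancel₀ _ hden
    have hI := eq_I_mul_im hneg hσ
    fin_cases i
    · refine (hasFDerivAt_primitive _ _ _ 0 1 ?_ hz).congr_fderiv ?_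
      -- The only real period that is not automatically zero; its vanishing is the formula for `σ²`.
      · have : (5 / 2 * ((b - a) ^ 2 * (1 - sigmaSq a b)) -
            2 * (b - a) * (4 * (b - 1)) * (1 - a * sigmaSq a b) : ℝ) = 0 := by
          linear_combination (b - a) / 2 * hs
        rw [one_mul]
        have t := congrArg (fun x : ℝ => (x : ℂ)) this
        push_cast at t ⊢
        rw [mul_zero]
        exact t
      · congr 1
        simp only [spinorPhi, leftSpinor, rightSpinor, denom_eq, numer_eq]
        simp
        field_simp
        rw [hσ]
        ring
    · refine (hasFDerivAt_primitive _ _ _ _ Complex.I ?_ hz).congr_fderiv ?_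
      · push_cast
        ring
      · congr 1
        simp only [spinorPhi, leftSpinor, rightSpinor, denom_eq, numer_eq]
        simp
        field_simp
        rw [hσ]
        ring
    · refine (hasFDerivAt_primitive _ _ _ _ (2 * σ) ?_ hz).congr_fderiv ?_
      · push_cast
        linear_combination (2 * (5 / 2 * ((b : ℂ) - a) ^ 2 - (b - a) * (4 * (b - 1)) * (1 + a))) * hI
      · congr 1
        simp only [spinorPhi, leftSpinor, rightSpinor, denom_eq, numer_eq]
        simp
        field_simp
        ring

end MinimalSurface
end

/-! ### Completeness -/

noncomputable section
namespace MinimalSurface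
open scoped ContDiff
open MeasureTheory Set Filter

/-- A spinor surface is complete if some exhaustion function has gradient bounded by a multiple of
the conformal factor. -/
lemma IsSpinorSurface.isComplete {X : ℂ → E3} {Ω : Set ℂ} {P Q : ℂ → ℂ}
    (h : IsSpinorSurface X Ω P Q) {f : ℂ → ℝ} (hf : ContDiffOn ℝ 1 f Ω) {C : ℝ} (hC : 0 ≤ C)
    (hb : ∀ z ∈ Ω, ∀ v, |fderiv ℝ f z v| ≤ C * (spinorNorm P Q z * ‖v‖))
    (hp : ∀ R : ℝ, ∃ K ⊆ Ω, IsCompact K ∧ ∀ z ∈ Ω, z ∉ K → R ≤ f z) :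
    IsCompleteSurface X Ω := by
  rintro γ ⟨⟨t, t0, tmono, tlim, tC⟩, hmem, hdiv⟩
  by_contra hfin
  have tnn : ∀ n, 0 ≤ t n := fun n => t0 ▸ tmono.monotone (Nat.zero_le n)
  set μ : ℝ → ENNReal := fun s => ‖fderiv ℝ X (γ s) (deriv γ s)‖ₑ with hμ
  have step : ∀ n, ‖f (γ (t (n + 1))) - f (γ (t n))‖ₑ ≤
      ENNReal.ofReal C * ∫⁻ s in Ico (t n) (t (n + 1)), μ s := by
    intro n
    have hlt := tmono (Nat.lt_succ_self n)
    have hmaps : MapsTo γ (Icc (t n) (t (n + 1))) Ω := fun s hs => hmem s ((tnn n).trans hs.1)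
    have h1 := enorm_sub_le_lintegral_deriv_of_contDiffOn_Icc (hf.comp (tC n) hmaps) hlt.le
    refine h1.trans ?_
    -- Passing to the open interval discards the break points, where `γ` need not be differentiable.
    rw [← lintegral_const_mul' _ _ ENNReal.ofReal_ne_top, ← restrict_Ioo_eq_restrict_Icc,
      ← restrict_Ioo_eq_restrict_Ico]
    refine setLIntegral_mono' measurableSet_Ioo fun s hs => ?_
    have hsΩ := hmaps (Ioo_subset_Icc_self hs)
    have d1 : DifferentiableAt ℝ γ s := ((tC n).differentiableOn (by simp)).differentiableAt
      (Icc_mem_nhds hs.1 hs.2)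
    have d2 : DifferentiableAt ℝ f (γ s) := (hf.differentiableOn (by simp)).differentiableAt
      (h.isOpen.mem_nhds hsΩ)
    have e1 : deriv (f ∘ γ) s = fderiv ℝ f (γ s) (deriv γ s) :=
      fderiv_comp_deriv s d2 d1
    have e2 := hb _ hsΩ (deriv γ s)
    rw [← h.norm_fderiv_apply hsΩ] at e2
    simp only [e1, hμ]
    rw [← ofReal_norm, ← ofReal_norm, ← ENNReal.ofReal_mul hC]
    exact ENNReal.ofReal_le_ofReal e2
  have total : ∀ n, ‖f (γ (t n)) - f (γ 0)‖ₑ ≤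
      ENNReal.ofReal C * ∫⁻ s in Ico 0 (t n), μ s := by
    intro n
    induction n with
    | zero => simp [t0]
    | succ n ih =>
      have hu : Ico 0 (t (n + 1)) = Ico 0 (t n) ∪ Ico (t n) (t (n + 1)) :=
        (Ico_union_Ico_eq_Ico (tnn n) (tmono (Nat.lt_succ_self n)).le).symm
      have hd : Disjoint (Ico 0 (t n)) (Ico (t n) (t (n + 1))) := by
        rw [Set.disjoint_left]
        intro s h1 h2
        exact absurd h1.2 (not_lt.2 h2.1)
      rw [hu, lintegral_union measurableSet_Ico hd, mul_add]
      refine le_trans ?_ (add_le_add ih (step n))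
      refine le_trans (le_of_eq ?_) (enorm_add_le _ _)
      congr 1
      ring
  have bound : ∀ n, f (γ (t n)) ≤ f (γ 0) + C * (pathLength X γ).toReal := by
    intro n
    have h1 : ‖f (γ (t n)) - f (γ 0)‖ₑ ≤ ENNReal.ofReal C * pathLength X γ :=
      (total n).trans (mul_le_mul_right (lintegral_mono_set Ico_subset_Ici_self) _)
    have h2 := ENNReal.toReal_mono (ENNReal.mul_ne_top ENNReal.ofReal_ne_top hfin) h1
    rw [toReal_enorm, ENNReal.toReal_mul, ENNReal.toReal_ofReal hC] at h2
    have h3 := le_abs_self (f (γ (t n)) - f (γ 0))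
    rw [Real.norm_eq_abs] at h2
    linarith
  obtain ⟨K, hK, hKc, hKf⟩ := hp (f (γ 0) + C * (pathLength X γ).toReal + 1)
  obtain ⟨n, hn⟩ := (tlim.eventually (hdiv K hK hKc)).exists
  have := hKf _ (hmem _ (tnn n)) hn
  linarith [bound n]

/-- An exhaustion function of the domain. -/
def exhaustion (z : ℂ) : ℝ :=
  2 * Real.log (1 + ‖z‖ ^ 2) - Real.log ‖z‖ - Real.log ‖z ^ 2 + 1‖

lemma hasFDerivAt_exhaustion {z : ℂ} (hz : z ∈ domain) :
    HasFDerivAt exhaustion (reMulCLM (4 * (starRingEnd ℂ) z / (1 + ‖z‖ ^ 2 : ℝ) - 1 / z -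
      2 * z / (z ^ 2 + 1))) z := by
  obtain ⟨h0, h1⟩ := (mem_domain_iff z).1 hz
  have d1 := hasFDerivAt_log_norm (hasDerivAt_id z) h0
  have d2 := hasFDerivAt_log_norm (((hasDerivAt_id z).pow 2).add_const 1) h1
  have hpos : 0 < 1 + ‖z‖ ^ 2 := by positivity
  have d3 := (((hasFDerivAt_id z (𝕜 := ℝ)).norm_sq).const_add 1).log hpos.ne'
  refine (((d3.const_mul 2).sub d1).sub d2).congr_fderiv ?_
  ext v
  have e : 4 * (starRingEnd ℂ) z / ((1 + ‖z‖ ^ 2 : ℝ) : ℂ) * v =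
      ((4 * (1 + ‖z‖ ^ 2)⁻¹ : ℝ) : ℂ) * ((starRingEnd ℂ) z * v) := by
    push_cast
    ring
  rw [reMulCLM_apply, sub_mul, sub_mul, Complex.sub_re, Complex.sub_re, e, Complex.re_ofReal_mul]
  simp
  ring

lemma contDiffOn_exhaustion : ContDiffOn ℝ 1 exhaustion domain := by
  have hn : ∀ f : ℂ → ℂ, ContDiff ℝ 1 f → (∀ z ∈ domain, f z ≠ 0) →
      ContDiffOn ℝ 1 (fun z => Real.log ‖f z‖) domain := fun f hf h0 =>
    (hf.contDiffOn.norm ℝ h0).log fun z hz => norm_ne_zero_iff.2 (h0 z hz)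
  have h1 := hn (fun z => z) contDiff_id fun z hz => ((mem_domain_iff z).1 hz).1
  have h2 := hn (fun z => z ^ 2 + 1) (by fun_prop) fun z hz => ((mem_domain_iff z).1 hz).2
  have h3 : ContDiffOn ℝ 1 (fun z : ℂ => Real.log (1 + ‖z‖ ^ 2)) domain := by
    refine ContDiff.contDiffOn ?_
    refine ContDiff.log (contDiff_const.add (contDiff_id.norm_sq ℝ)) fun z => ?_
    positivity
  exact ((contDiffOn_const.mul h3).sub h1).sub h2

lemma exhaustion_proper (R : ℝ) :
    ∃ K ⊆ domain, IsCompact K ∧ ∀ z ∈ domain, z ∉ K → R ≤ exhaustion z := by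
  set S := Real.exp R
  have hS : 0 < S := Real.exp_pos R
  refine ⟨{z | ‖z‖ ≤ S ∧ S⁻¹ ≤ ‖z‖ ∧ S⁻¹ ≤ ‖z ^ 2 + 1‖}, ?_, ?_, ?_⟩
  · rintro z ⟨-, h2, h3⟩
    rw [mem_domain_iff]
    have : 0 < S⁻¹ := inv_pos.2 hS
    exact ⟨norm_pos_iff.1 (this.trans_le h2), norm_pos_iff.1 (this.trans_le h3)⟩
  · refine (isCompact_closedBall (0 : ℂ) S).of_isClosed_subset ?_ fun z hz => ?_
    · have c1 : Continuous fun z : ℂ => ‖z‖ := by fun_prop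
      have c2 : Continuous fun z : ℂ => ‖z ^ 2 + 1‖ := by fun_prop
      exact (isClosed_le c1 continuous_const).inter
        ((isClosed_le continuous_const c1).inter (isClosed_le continuous_const c2))
    · simpa using hz.1
  · intro z hz hK
    obtain ⟨h0, h1⟩ := (mem_domain_iff z).1 hz
    set r := ‖z‖ with hr
    set m := ‖z ^ 2 + 1‖ with hm
    have r0 : 0 < r := norm_pos_iff.2 h0
    have m0 : 0 < m := norm_pos_iff.2 h1
    have hm1 : m ≤ 1 + r ^ 2 := by
      have := norm_add_le (z ^ 2) 1
      rw [norm_pow, norm_one] at this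
      linarith
    have he : exhaustion z = Real.log ((1 + r ^ 2) ^ 2 / (r * m)) := by
      rw [Real.log_div (by positivity) (by positivity), Real.log_mul r0.ne' m0.ne', Real.log_pow,
        exhaustion]
      push_cast
      ring
    rw [he, Real.le_log_iff_exp_le (by positivity), le_div_iff₀ (by positivity)]
    -- Failure of the bound means `(1+r²)² < S r m`. With `m ≤ 1+r²` this gives `1+r² < S r`, which
    -- bounds `r` on both sides; with `r ≤ (1+r²)²` it gives `1 < S m`.
    by_contra! hlt
    change (1 + r ^ 2) ^ 2 < S * (r * m) at hlt
    have a1 : 1 + r ^ 2 < S * r := by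
      by_contra! hh
      have : S * r * m ≤ (1 + r ^ 2) * (1 + r ^ 2) :=
        mul_le_mul hh hm1 m0.le (by positivity)
      nlinarith
    refine hK ⟨?_, ?_, ?_⟩
    · by_contra! hh
      nlinarith
    · rw [inv_le_iff_one_le_mul₀' hS]
      nlinarith
    · rw [inv_le_iff_one_le_mul₀' hS]
      by_contra! hh
      have : S * m * r ≤ r := by nlinarith
      nlinarith [sq_nonneg (r - 1), sq_nonneg (r ^ 2)]

/-- Two linear forms `U + V`, `τ (U + a V)` control `U` and `V`. -/
lemma normSq_le_pencil {a : ℝ} (ha : a ≠ 1) {τ : ℂ} (hτ : τ ≠ 0) :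
    ∃ c : ℝ, 0 < c ∧ ∀ U V : ℂ, c * (‖U‖ ^ 2 + ‖V‖ ^ 2) ≤ ‖U + V‖ ^ 2 + ‖τ * (U + a * V)‖ ^ 2 := by
  have ha' : (a : ℂ) - 1 ≠ 0 := by exact_mod_cast sub_ne_zero.2 ha
  -- `(U, V) ↦ (U + V, τ(U + aV))` is invertible because `a ≠ 1`. The numerator adds the
  -- coefficients of both inversion formulas, so that one `M` bounds `U` and `V`.
  set M := (‖τ‖ + 1 + (‖τ‖ * |a| + 1)) / (‖τ‖ * ‖(a : ℂ) - 1‖) with hM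
  have hτ' : 0 < ‖τ‖ := norm_pos_iff.2 hτ
  have ha'' : 0 < ‖(a : ℂ) - 1‖ := norm_pos_iff.2 ha'
  have hMpos : 0 < M := by positivity
  refine ⟨1 / (4 * M ^ 2), by positivity, fun U V => ?_⟩
  set x := ‖U + V‖
  set y := ‖τ * (U + a * V)‖
  have x0 : 0 ≤ x := norm_nonneg _
  have y0 : 0 ≤ y := norm_nonneg _
  have hV : ‖V‖ ≤ M * (x + y) := by
    rw [hM, div_mul_eq_mul_div, le_div_iff₀ (by positivity)]
    have e : V * (τ * ((a : ℂ) - 1)) = τ * (U + a * V) - τ * (U + V) := by ring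
    have := norm_sub_le (τ * (U + a * V)) (τ * (U + V))
    rw [← e, norm_mul, norm_mul, norm_mul τ (U + V)] at this
    change _ ≤ y + ‖τ‖ * x at this
    have p1 : 0 ≤ ‖τ‖ * y := by positivity
    have p2 : 0 ≤ ‖τ‖ * |a| * (x + y) := by positivity
    nlinarith
  have hU : ‖U‖ ≤ M * (x + y) := by
    rw [hM, div_mul_eq_mul_div, le_div_iff₀ (by positivity)]
    have e : U * (τ * ((a : ℂ) - 1)) = τ * a * (U + V) - τ * (U + a * V) := by ring
    have := norm_sub_le (τ * a * (U + V)) (τ * (U + a * V))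
    rw [← e, norm_mul, norm_mul, norm_mul (τ * a) (U + V), norm_mul τ, Complex.norm_real,
      Real.norm_eq_abs] at this
    change _ ≤ ‖τ‖ * |a| * x + y at this
    have p1 : 0 ≤ ‖τ‖ * |a| * y := by positivity
    have p2 : 0 ≤ ‖τ‖ * (x + y) := by positivity
    nlinarith
  rw [one_div, inv_mul_le_iff₀ (by positivity)]
  have q1 : ‖U‖ ^ 2 ≤ (M * (x + y)) ^ 2 := pow_le_pow_left₀ (norm_nonneg _) hU 2
  have q2 : ‖V‖ ^ 2 ≤ (M * (x + y)) ^ 2 := pow_le_pow_left₀ (norm_nonneg _) hV 2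
  have q3 : (M * (x + y)) ^ 2 ≤ 2 * M ^ 2 * (x ^ 2 + y ^ 2) := by
    nlinarith [mul_nonneg (sq_nonneg M) (sq_nonneg (x - y))]
  linarith

/-- Here `r = |z|` and `m = |z²+1|`. The left side is at most `5(1/r) + 2(r/m)`, with `1/r` at most
`4` times and `r/m` at most `2` times the bracket, whence `24 = 5·4 + 2·2`. -/
lemma elementary_gradient_bound {r m : ℝ} (hr : 0 < r) (hm : 0 < m) (h1 : m ≤ 1 + r ^ 2)
    (h2 : 1 - r ^ 2 ≤ m) :
    4 * r / (1 + r ^ 2) + 1 / r + 2 * r / m ≤ 24 * (r ^ 6 / m ^ 2 + 1 / r ^ 2) := by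
  have b0 : 4 * r / (1 + r ^ 2) ≤ 4 * (1 / r) := by
    rw [mul_one_div, div_le_div_iff₀ (by positivity) hr]
    nlinarith
  have am : 2 * (r ^ 2 / m) ≤ r ^ 6 / m ^ 2 + 1 / r ^ 2 := by
    have e : 0 ≤ (r ^ 3 / m - 1 / r) ^ 2 := sq_nonneg _
    have e2 : (r ^ 3 / m - 1 / r) ^ 2 = r ^ 6 / m ^ 2 + 1 / r ^ 2 - 2 * (r ^ 2 / m) := by
      field_simp
      ring
    linarith
  have p1 : 0 < r ^ 6 / m ^ 2 := by positivity
  have p2 : 0 < 1 / r ^ 2 := by positivity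
  have b1 : 1 / r ≤ 4 * (r ^ 6 / m ^ 2 + 1 / r ^ 2) := by
    rcases le_total r 1 with h | h
    · have : 1 / r ≤ 1 / r ^ 2 := one_div_le_one_div_of_le (by positivity) (by nlinarith)
      linarith
    · have : 1 / r ≤ 4 * (r ^ 6 / m ^ 2) := by
        rw [← mul_div_assoc, div_le_div_iff₀ hr (by positivity)]
        have c1 : m ^ 2 ≤ (2 * r ^ 2) ^ 2 := pow_le_pow_left₀ hm.le (by nlinarith) 2
        have c2 : 1 ≤ r ^ 3 := one_le_pow₀ h
        have c3 : r ^ 4 ≤ r ^ 4 * r ^ 3 := le_mul_of_one_le_right (by positivity) c2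
        nlinarith
      linarith
  have b2 : r / m ≤ 2 * (r ^ 6 / m ^ 2 + 1 / r ^ 2) := by
    rcases le_total r (1 / 2) with h | h
    · have c : r / m ≤ 2 * (1 / r ^ 2) := by
        rw [mul_one_div, div_le_div_iff₀ hm (by positivity)]
        have c1 : 3 / 4 ≤ m := by nlinarith
        have c2 : r ^ 3 ≤ (1 / 2) ^ 3 := pow_le_pow_left₀ hr.le h 3
        nlinarith
      linarith
    · have c : r / m ≤ 2 * (r ^ 2 / m) := by
        rw [← mul_div_assoc, div_le_div_iff_of_pos_right hm]
        nlinarith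
      linarith
  have e : 2 * r / m = 2 * (r / m) := mul_div_assoc _ _ _
  rw [e]
  linarith

/-- Apply `normSq_le_pencil` to `U = d z⁴` and `V = e(z²+1)`. Their squared norms, divided by
`|z|²|z²+1|²`, are `d²|z|⁶/|z²+1|²` and `e²/|z|²`. -/
lemma spinorNorm_lower_bound {a b : ℝ} {σ : ℂ} (ha : a ≠ 1) (hb : b ≠ 1) (hab : a ≠ b)
    (hσ : σ ≠ 0) :
    ∃ c : ℝ, 0 < c ∧ ∀ z ∈ domain, c * (‖z‖ ^ 6 / ‖z ^ 2 + 1‖ ^ 2 + 1 / ‖z‖ ^ 2) ≤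
      spinorNorm (leftSpinor a b) (rightSpinor a b σ) z := by
  obtain ⟨c, hc, hle⟩ := normSq_le_pencil ha hσ
  set d := b - a with hd
  set e := 4 * (b - 1) with he
  have d0 : 0 < d ^ 2 := by
    have : d ≠ 0 := sub_ne_zero.2 hab.symm
    positivity
  have e0 : 0 < e ^ 2 := by
    have : e ≠ 0 := mul_ne_zero four_ne_zero (sub_ne_zero.2 hb)
    positivity
  refine ⟨c * min (d ^ 2) (e ^ 2), mul_pos hc (lt_min d0 e0), fun z hz => ?_⟩
  obtain ⟨h0, h1⟩ := (mem_domain_iff z).1 hz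
  have r0 : 0 < ‖z‖ := norm_pos_iff.2 h0
  have m0 : 0 < ‖z ^ 2 + 1‖ := norm_pos_iff.2 h1
  have key := hle ((d : ℂ) * z ^ 4) ((e : ℂ) * (z ^ 2 + 1))
  have k1 : (d : ℂ) * z ^ 4 + (e : ℂ) * (z ^ 2 + 1) = denom a b z := by
    rw [denom_eq, hd, he]
    push_cast
    ring
  have k2 : (d : ℂ) * z ^ 4 + a * ((e : ℂ) * (z ^ 2 + 1)) = numer a b z := by
    rw [numer_eq, hd, he]
    push_cast
    ring
  rw [k1, k2] at key
  have k3 : spinorNorm (leftSpinor a b) (rightSpinor a b σ) z =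
      (‖denom a b z‖ ^ 2 + ‖σ * numer a b z‖ ^ 2) / (‖z‖ * ‖z ^ 2 + 1‖) ^ 2 := by
    simp only [spinorNorm, leftSpinor, rightSpinor, Complex.normSq_eq_norm_sq, norm_div,
      norm_mul z, div_pow]
    ring
  rw [k3, le_div_iff₀ (by positivity)]
  refine le_trans ?_ key
  have k4 : (‖z‖ ^ 6 / ‖z ^ 2 + 1‖ ^ 2 + 1 / ‖z‖ ^ 2) * (‖z‖ * ‖z ^ 2 + 1‖) ^ 2 =
      ‖z‖ ^ 8 + ‖z ^ 2 + 1‖ ^ 2 := by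
    field_simp
  rw [mul_assoc, k4, mul_assoc]
  refine mul_le_mul_of_nonneg_left ?_ hc.le
  rw [norm_mul, norm_mul, Complex.norm_real, Complex.norm_real, Real.norm_eq_abs,
    Real.norm_eq_abs, mul_pow |d|, mul_pow |e|, sq_abs, sq_abs, norm_pow, ← pow_mul, mul_add]
  exact add_le_add (mul_le_mul_of_nonneg_right (min_le_left _ _) (by positivity))
    (mul_le_mul_of_nonneg_right (min_le_right _ _) (by positivity))

lemma isComplete_surface {a b : ℝ} {σ : ℂ} (ha : a ≠ 1) (hb : b ≠ 1) (hab : a ≠ b)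
    (hneg : sigmaSq a b < 0) (hσ : σ ^ 2 = ((sigmaSq a b : ℝ) : ℂ)) :
    IsCompleteSurface (surface a b σ) domain := by
  have hσ0 : σ ≠ 0 := by
    rintro rfl
    rw [zero_pow two_ne_zero] at hσ
    exact hneg.ne (by exact_mod_cast hσ.symm)
  obtain ⟨c, hc, hle⟩ := spinorNorm_lower_bound ha hb hab hσ0
  refine (isSpinorSurface_surface ha hb hneg hσ).isComplete contDiffOn_exhaustion
    (C := 24 / c) (by positivity) (fun z hz v => ?_) exhaustion_proper
  obtain ⟨h0, h1⟩ := (mem_domain_iff z).1 hz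
  have r0 : 0 < ‖z‖ := norm_pos_iff.2 h0
  have m0 : 0 < ‖z ^ 2 + 1‖ := norm_pos_iff.2 h1
  rw [(hasFDerivAt_exhaustion hz).fderiv, reMulCLM_apply]
  refine (Complex.abs_re_le_norm _).trans ?_
  rw [norm_mul, ← mul_assoc]
  refine mul_le_mul_of_nonneg_right ?_ (norm_nonneg v)
  have g1 : ‖4 * (starRingEnd ℂ) z / (1 + ‖z‖ ^ 2 : ℝ) - 1 / z - 2 * z / (z ^ 2 + 1)‖ ≤
      4 * ‖z‖ / (1 + ‖z‖ ^ 2) + 1 / ‖z‖ + 2 * ‖z‖ / ‖z ^ 2 + 1‖ := by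
    refine (norm_sub_le _ _).trans (add_le_add ((norm_sub_le _ _).trans
      (add_le_add (le_of_eq ?_) (le_of_eq ?_))) (le_of_eq ?_))
    · have hp : 0 ≤ 1 + ‖z‖ ^ 2 := by positivity
      rw [norm_div, norm_mul, Complex.norm_real, Real.norm_of_nonneg hp, RCLike.norm_conj]
      simp
    · simp
    · simp
  have hm1 : ‖z ^ 2 + 1‖ ≤ 1 + ‖z‖ ^ 2 := by
    have := norm_add_le (z ^ 2) 1
    rw [norm_pow, norm_one] at this
    linarith
  have hm2 : 1 - ‖z‖ ^ 2 ≤ ‖z ^ 2 + 1‖ := by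
    have := norm_sub_le (z ^ 2 + 1) (z ^ 2)
    rw [add_sub_cancel_left, norm_pow, norm_one] at this
    linarith
  refine (g1.trans (elementary_gradient_bound r0 m0 hm1 hm2)).trans ?_
  have := hle z hz
  rw [div_mul_eq_mul_div, le_div_iff₀ hc]
  nlinarith

end MinimalSurface
end

/-! ### Total curvature as four times the area of the sphere -/

noncomputable section
namespace MinimalSurface
open MeasureTheory Set Filter Topology

lemma det_restrictScalars_toSpanSingleton (c : ℂ) :
    ((ContinuousLinearMap.toSpanSingleton ℂ c).restrictScalars ℝ).det = Complex.normSq c := by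
  rw [← Algebra.norm_complex_apply, Algebra.norm_apply]
  change LinearMap.det _ = LinearMap.det _
  congr 1
  ext x
  simp [mul_comm]

lemma lintegral_image_eq_of_hasDerivAt {f f' : ℂ → ℂ} {s : Set ℂ} (hs : MeasurableSet s)
    (hf : ∀ z ∈ s, HasDerivAt f (f' z) z) (hi : InjOn f s) (F : ℂ → ENNReal) :
    ∫⁻ w in f '' s, F w = ∫⁻ z in s, ENNReal.ofReal (Complex.normSq (f' z)) * F (f z) := by
  rw [lintegral_image_eq_lintegral_abs_det_fderiv_mul volume hs
    (fun z hz => ((hf z hz).hasFDerivAt.restrictScalars ℝ).hasFDerivWithinAt) hi]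
  simp only [det_restrictScalars_toSpanSingleton, abs_of_nonneg (Complex.normSq_nonneg _)]

/-- `f` is holomorphic off a countable set, has countable fibres, and pulls back area integrals with
multiplicity `n`. -/
structure HasAreaDegree (f : ℂ → ℂ) (n : ℕ) : Prop where
  lintegral_eq : ∀ F : ℂ → ENNReal,
    ∫⁻ z, ENNReal.ofReal (Complex.normSq (deriv f z)) * F (f z) = n * ∫⁻ w, F w
  countable_fibre : ∀ w, (f ⁻¹' {w}).Countable
  countable_singular : {z | ¬ DifferentiableAt ℂ f z}.Countable

lemma HasAreaDegree.countable_preimage {f : ℂ → ℂ} {n : ℕ} (hf : HasAreaDegree f n) {C : Set ℂ}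
    (hC : C.Countable) : (f ⁻¹' C).Countable := by
  rw [← biUnion_preimage_singleton]
  exact hC.biUnion fun w _ => hf.countable_fibre w

lemma HasAreaDegree.comp {f g : ℂ → ℂ} {n m : ℕ} (hf : HasAreaDegree f n)
    (hg : HasAreaDegree g m) : HasAreaDegree (f ∘ g) (m * n) := by
  have hc : ({z | ¬ DifferentiableAt ℂ g z} ∪ g ⁻¹' {w | ¬ DifferentiableAt ℂ f w}).Countable :=
    hg.countable_singular.union (hg.countable_preimage hf.countable_singular)
  refine ⟨fun F => ?_, fun w => ?_, hc.mono fun z hz => ?_⟩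
  · have h1 := hg.lintegral_eq fun w => ENNReal.ofReal (Complex.normSq (deriv f w)) * F (f w)
    rw [hf.lintegral_eq, ← mul_assoc] at h1
    rw [Nat.cast_mul, ← h1]
    refine lintegral_congr_ae ?_
    filter_upwards [hc.ae_notMem volume] with z hz
    simp only [mem_union, mem_ofPred_eq, mem_preimage, not_or, not_not] at hz
    rw [deriv_comp z hz.2 hz.1, Complex.normSq_mul, ENNReal.ofReal_mul (Complex.normSq_nonneg _),
      Function.comp_apply]
    ring
  · rw [preimage_comp]
    exact hg.countable_preimage (hf.countable_fibre w)
  · by_contra h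
    simp only [mem_union, mem_ofPred_eq, mem_preimage, not_or, not_not] at h
    exact hz (h.2.comp z h.1)

lemma volume_re_eq_zero : volume {z : ℂ | z.re = 0} = 0 := by
  have h : ({z : ℂ | z.re = 0} : Set ℂ) = (LinearMap.ker Complex.reLm : Submodule ℝ ℂ) := by
    ext z
    simp
  rw [h]
  refine Measure.addHaar_submodule _ _ fun h => ?_
  have : (1 : ℂ) ∈ LinearMap.ker Complex.reLm := h ▸ Submodule.mem_top
  simp at this

lemma volume_im_eq_zero : volume {z : ℂ | z.im = 0} = 0 := by
  have h : ({z : ℂ | z.im = 0} : Set ℂ) = (LinearMap.ker Complex.imLm : Submodule ℝ ℂ) := by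
    ext z
    simp
  rw [h]
  refine Measure.addHaar_submodule _ _ fun h => ?_
  have : Complex.I ∈ LinearMap.ker Complex.imLm := h ▸ Submodule.mem_top
  simp at this

lemma eq_of_sq_eq_of_re_pos {z w : ℂ} (h : z ^ 2 = w ^ 2) (hp : 0 < z.re * w.re) : z = w := by
  rcases sq_eq_sq_iff_eq_or_eq_neg.1 h with h | h
  · exact h
  · rw [h] at hp
    simp only [Complex.neg_re] at hp
    nlinarith [mul_self_nonneg w.re]

lemma im_ne_zero_mem_image_sq {w : ℂ} (hw : w.im ≠ 0) :
    w ∈ (fun z : ℂ => z ^ 2) '' {z | 0 < z.re} ∧ w ∈ (fun z : ℂ => z ^ 2) '' {z | z.re < 0} := by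
  obtain ⟨z, hz⟩ := IsAlgClosed.exists_pow_nat_eq w two_pos
  have h0 : z.re ≠ 0 := by
    intro h
    rw [← hz] at hw
    simp [pow_two, h] at hw
  rcases lt_or_gt_of_ne h0 with h | h
  · exact ⟨⟨-z, by simpa using h, by simpa using hz⟩, ⟨z, h, hz⟩⟩
  · exact ⟨⟨z, h, hz⟩, ⟨-z, by simpa using h, by simpa using hz⟩⟩

lemma hasAreaDegree_sq : HasAreaDegree (fun z => z ^ 2) 2 := by
  have hd : ∀ z : ℂ, HasDerivAt (fun z : ℂ => z ^ 2) (2 * z) z := fun z => by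
    simpa using hasDerivAt_pow 2 z
  refine ⟨fun F => ?_, fun w => ?_, ?_⟩
  · have m1 : MeasurableSet {z : ℂ | 0 < z.re} := measurableSet_lt measurable_const Complex.measurable_re
    have m2 : MeasurableSet {z : ℂ | z.re < 0} := measurableSet_lt Complex.measurable_re measurable_const
    -- Squaring is injective on each open half-plane, and each image contains everything off the
    -- real axis, a null set; hence the multiplicity `2`.
    have full : ∀ s : Set ℂ, (∀ w : ℂ, w.im ≠ 0 → w ∈ s) → ∫⁻ w in s, F w = ∫⁻ w, F w := by
      intro s hs
      refine (setLIntegral_congr (eventuallyEq_univ.2 ?_)).trans (setLIntegral_univ F)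
      filter_upwards [measure_eq_zero_iff_ae_notMem.1 volume_im_eq_zero] with w hw using hs w hw
    have e1 := lintegral_image_eq_of_hasDerivAt m1 (fun z _ => hd z)
      (fun z hz w hw h => eq_of_sq_eq_of_re_pos h (mul_pos hz hw)) F
    have e2 := lintegral_image_eq_of_hasDerivAt m2 (fun z _ => hd z)
      (fun z hz w hw h => eq_of_sq_eq_of_re_pos h (mul_pos_of_neg_of_neg hz hw)) F
    rw [full _ fun w hw => (im_ne_zero_mem_image_sq hw).1] at e1
    rw [full _ fun w hw => (im_ne_zero_mem_image_sq hw).2] at e2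
    have hdisj : Disjoint {z : ℂ | 0 < z.re} {z : ℂ | z.re < 0} := by
      rw [Set.disjoint_left]
      intro z h1 h2
      exact lt_asymm (show 0 < z.re from h1) h2
    have hu : ({z : ℂ | 0 < z.re} ∪ {z : ℂ | z.re < 0} : Set ℂ) =ᵐ[volume] univ := by
      refine eventuallyEq_univ.2 ?_
      filter_upwards [measure_eq_zero_iff_ae_notMem.1 volume_re_eq_zero] with w hw
      exact (lt_or_gt_of_ne hw).symm
    simp only [(hd _).deriv]
    rw [← setLIntegral_univ, ← setLIntegral_congr hu, lintegral_union m2 hdisj, ← e1, ← e2]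
    push_cast
    ring
  · obtain ⟨z, hz⟩ := IsAlgClosed.exists_pow_nat_eq w two_pos
    refine (Set.toFinite {z, -z}).countable.mono fun y hy => ?_
    have : y ^ 2 = z ^ 2 := by rw [hz]; exact hy
    exact sq_eq_sq_iff_eq_or_eq_neg.1 this
  · convert countable_empty
    ext z
    simp

/-- The fractional linear map `z ↦ (α z + β) / (γ z + δ)`. -/
def moebius (α β γ δ z : ℂ) : ℂ := (α * z + β) / (γ * z + δ)

lemma hasAreaDegree_moebius {α β γ δ : ℂ} (hγ : γ ≠ 0) (hdet : α * δ - β * γ ≠ 0) :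
    HasAreaDegree (moebius α β γ δ) 1 := by
  have hne : ∀ z, z ≠ -δ / γ → γ * z + δ ≠ 0 := fun z hz h => hz (by
    rw [eq_div_iff hγ]
    linear_combination h)
  have hd : ∀ z ∈ ({-δ / γ}ᶜ : Set ℂ), HasDerivAt (moebius α β γ δ)
      (((α * 1) * (γ * z + δ) - (α * z + β) * (γ * 1)) / (γ * z + δ) ^ 2) z := fun z hz =>
    (((hasDerivAt_id z).const_mul α).add_const β).div
      (((hasDerivAt_id z).const_mul γ).add_const δ) (hne z hz)
  have hinj : InjOn (moebius α β γ δ) {-δ / γ}ᶜ := by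
    intro z hz w hw h
    simp only [moebius] at h
    rw [div_eq_div_iff (hne z hz) (hne w hw)] at h
    have : (α * δ - β * γ) * (z - w) = 0 := by linear_combination h
    exact sub_eq_zero.1 ((mul_eq_zero.1 this).resolve_left hdet)
  have m : MeasurableSet ({-δ / γ}ᶜ : Set ℂ) := (measurableSet_singleton _).compl
  have hae : ∀ c : ℂ, ({c}ᶜ : Set ℂ) =ᵐ[volume] univ := fun c => eventuallyEq_univ.2 (by
    filter_upwards [(countable_singleton c).ae_notMem volume] with z hz using hz)
  refine ⟨fun F => ?_, fun w => ?_, ?_⟩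
  · have e := lintegral_image_eq_of_hasDerivAt m (fun z hz => (hd z hz).differentiableAt.hasDerivAt)
      hinj F
    -- The image misses at most `α/γ`, the value at infinity; the witness is the inverse Möbius map.
    have himg : {α / γ}ᶜ ⊆ moebius α β γ δ '' {-δ / γ}ᶜ := by
      intro w hw
      have hw' : α - γ * w ≠ 0 := fun h => hw (by
        rw [mem_singleton_iff, eq_div_iff hγ]
        linear_combination -h)
      have hk : γ * ((δ * w - β) / (α - γ * w)) + δ = (α * δ - β * γ) / (α - γ * w) := by
        field_simp
        ring
      have hk0 : γ * ((δ * w - β) / (α - γ * w)) + δ ≠ 0 := by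
        rw [hk]
        exact div_ne_zero hdet hw'
      refine ⟨(δ * w - β) / (α - γ * w), fun h => hk0 ?_, ?_⟩
      · rw [mem_singleton_iff] at h
        rw [h]
        field_simp
        ring
      · rw [moebius, div_eq_iff hk0, hk]
        have hk1 : α * ((δ * w - β) / (α - γ * w)) + β =
            (α * (δ * w - β) + β * (α - γ * w)) / (α - γ * w) := by
          rw [add_div, mul_div_cancel_right₀ _ hw', mul_div_assoc]
        rw [hk1]
        ring
    have hf : (moebius α β γ δ '' {-δ / γ}ᶜ : Set ℂ) =ᵐ[volume] univ :=
      eventuallyEq_univ.2 (mem_of_superset (eventuallyEq_univ.1 (hae (α / γ))) himg)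
    rw [setLIntegral_congr hf, setLIntegral_congr (hae _), setLIntegral_univ,
      setLIntegral_univ] at e
    rw [← e, Nat.cast_one, one_mul]
  · have hs : (moebius α β γ δ ⁻¹' {w} ∩ {-δ / γ}ᶜ).Subsingleton := by
      rintro z ⟨hz1, hz2⟩ y ⟨hy1, hy2⟩
      exact hinj hz2 hy2 (hz1.trans hy1.symm)
    refine ((countable_singleton (-δ / γ)).union hs.countable).mono fun z hz => ?_
    by_cases h : z = -δ / γ
    · exact Or.inl h
    · exact Or.inr ⟨hz, h⟩
  · refine (countable_singleton (-δ / γ)).mono fun z hz => ?_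
    by_contra h
    exact hz (hd z h).differentiableAt

/-- The area density of the round sphere in the stereographic coordinate. -/
def sphereDensity (w : ℂ) : ℝ := 4 / (1 + ‖w‖ ^ 2) ^ 2

lemma lintegral_sphereDensity :
    ∫⁻ w, ENNReal.ofReal (sphereDensity w) = ENNReal.ofReal (4 * Real.pi) := by
  -- In polar coordinates the radial integrand `4y/(1+y²)²` has primitive `-2/(1+y²)`, so its
  -- integral is `2`, and the angle contributes `2π`.
  have hd : ∀ y ∈ Ioi (0 : ℝ), HasDerivAt (fun y : ℝ => -2 / (1 + y ^ 2))
      (y ^ (2 - 1) • (4 / (1 + y ^ 2) ^ 2)) y := by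
    intro y _
    have h0 : (1 + y ^ 2) ≠ 0 := by positivity
    refine ((hasDerivAt_const y (-2 : ℝ)).div ((hasDerivAt_pow 2 y).const_add 1) h0).congr_deriv ?_
    simp
    ring
  have hc : ContinuousWithinAt (fun y : ℝ => -2 / (1 + y ^ 2)) (Ici 0) 0 := by
    have : Continuous (fun y : ℝ => -2 / (1 + y ^ 2)) :=
      continuous_const.div (by fun_prop) fun y => by positivity
    exact this.continuousWithinAt
  have ht : Tendsto (fun y : ℝ => -2 / (1 + y ^ 2)) atTop (𝓝 0) :=
    tendsto_const_nhds.div_atTop (tendsto_atTop_add_const_left _ _ (tendsto_pow_atTop two_ne_zero))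
  have hpos : ∀ y ∈ Ioi (0 : ℝ), 0 ≤ y ^ (2 - 1) • (4 / (1 + y ^ 2) ^ 2) := by
    intro y hy
    have : 0 < y := hy
    simp only [smul_eq_mul]
    positivity
  have hint := integrableOn_Ioi_deriv_of_nonneg hc hd hpos ht
  have hval := integral_Ioi_of_hasDerivAt_of_nonneg hc hd hpos ht
  have hI : Integrable sphereDensity := by
    have := (integrable_fun_norm_addHaar (volume : Measure ℂ)
      (f := fun y : ℝ => 4 / (1 + y ^ 2) ^ 2)).2 (by
        rw [Complex.finrank_real_complex]
        exact hint)
    exact this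
  have hV : ∫ w, sphereDensity w = 4 * Real.pi := by
    have := integral_fun_norm_addHaar (volume : Measure ℂ)
      (fun y : ℝ => 4 / (1 + y ^ 2) ^ 2)
    rw [Complex.finrank_real_complex, hval] at this
    change ∫ w, sphereDensity w = _ at this
    rw [this]
    simp [Measure.real]
    ring
  rw [← hV, ofReal_integral_eq_lintegral_ofReal hI]
  filter_upwards with w
  unfold sphereDensity
  positivity

/-- The factorization of the Gauss map through two squarings and two fractional linear maps. -/
def gaussFactorization (a b : ℝ) (σ : ℂ) : ℂ → ℂ :=
  ((moebius (-σ * b * (1 - a)) (σ * a * (1 - b)) (-(1 - a)) (1 - b) ∘ fun z => z ^ 2) ∘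
    moebius 1 0 1 2) ∘ fun z => z ^ 2

lemma hasAreaDegree_gaussFactorization {a b : ℝ} {σ : ℂ} (ha : a ≠ 1) (hb : b ≠ 1) (hab : a ≠ b)
    (hσ : σ ≠ 0) : HasAreaDegree (gaussFactorization a b σ) 4 := by
  have ha' : 1 - (a : ℂ) ≠ 0 := by exact_mod_cast sub_ne_zero.2 ha.symm
  have hb' : 1 - (b : ℂ) ≠ 0 := by exact_mod_cast sub_ne_zero.2 hb.symm
  have hab' : (a : ℂ) - b ≠ 0 := by exact_mod_cast sub_ne_zero.2 hab
  have h1 : HasAreaDegree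
      (moebius (-σ * b * (1 - a)) (σ * a * (1 - b)) (-(1 - a)) (1 - b)) 1 := by
    refine hasAreaDegree_moebius (neg_ne_zero.2 ha') ?_
    have : -σ * b * (1 - a) * (1 - b) - σ * a * (1 - b) * -(1 - a) =
        σ * (1 - a) * (1 - b) * ((a : ℂ) - b) := by ring
    rw [this]
    exact mul_ne_zero (mul_ne_zero (mul_ne_zero hσ ha') hb') hab'
  exact ((h1.comp hasAreaDegree_sq).comp (hasAreaDegree_moebius one_ne_zero (by simp))).comp
    hasAreaDegree_sq

/-- In `u = z²` the map is a Möbius function of `u²/(u+1)`, with critical points `0` and `-2`. The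
coordinate `u/(u+2)` sends these to `0` and `∞`, so a quadratic map becomes a square followed by a
Möbius map. -/
lemma gaussFactorization_eq {a b : ℝ} {σ z : ℂ} (hD : denom a b z ≠ 0) (hz : z ^ 2 + 2 ≠ 0) :
    gaussFactorization a b σ z = σ * numer a b z / denom a b z := by
  have h2 : z ^ 2 / (z ^ 2 + 2) = moebius 1 0 1 2 (z ^ 2) := by simp [moebius]
  simp only [gaussFactorization, Function.comp_apply, ← h2]
  have e1 : -(1 - (a : ℂ)) * (z ^ 2 / (z ^ 2 + 2)) ^ 2 + (1 - b) =
      -denom a b z / (z ^ 2 + 2) ^ 2 := by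
    rw [denom]
    field_simp
    ring
  have e2 : -σ * b * (1 - (a : ℂ)) * (z ^ 2 / (z ^ 2 + 2)) ^ 2 + σ * a * (1 - b) =
      -(σ * numer a b z) / (z ^ 2 + 2) ^ 2 := by
    rw [numer]
    field_simp
    ring
  rw [moebius, e1, e2]
  field_simp

/-- As `(Q/P)' = -W/P²`, the curvature density is the spherical area density pulled back by the
Gauss map. -/
lemma curvature_integrand_eq {P Q : ℂ → ℂ} {z : ℂ} (hP : DifferentiableAt ℂ P z)
    (hQ : DifferentiableAt ℂ Q z) (h0 : P z ≠ 0) :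
    4 * Complex.normSq (spinorWronskian P Q z) / spinorNorm P Q z ^ 2 =
      Complex.normSq (deriv (fun w => Q w / P w) z) * sphereDensity (Q z / P z) := by
  have hd : deriv (fun w => Q w / P w) z = -spinorWronskian P Q z / P z ^ 2 := by
    rw [deriv_fun_div hQ hP h0, spinorWronskian]
    ring
  have hn : 0 < Complex.normSq (P z) := Complex.normSq_pos.2 h0
  have hm : 0 ≤ Complex.normSq (Q z) := Complex.normSq_nonneg _
  rw [hd, sphereDensity, ← Complex.normSq_eq_norm_sq]
  simp only [map_div₀, Complex.normSq_neg, map_pow, spinorNorm]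
  have : 1 + Complex.normSq (Q z) / Complex.normSq (P z) =
      (Complex.normSq (P z) + Complex.normSq (Q z)) / Complex.normSq (P z) := by
    field_simp
  rw [this]
  have : 0 < Complex.normSq (P z) + Complex.normSq (Q z) := by linarith
  field_simp

lemma finite_denom_zeros {a b : ℝ} (hab : a ≠ b) : {z : ℂ | denom a b z = 0}.Finite := by
  open Polynomial in
  set p : ℂ[X] := C ((b : ℂ) - a) * X ^ 4 + C (4 * ((b : ℂ) - 1)) * X ^ 2 + C (4 * ((b : ℂ) - 1))
  have hp : p ≠ 0 := by
    intro h
    have h4 := congrArg (fun q => Polynomial.coeff q 4) h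
    simp [p, Polynomial.coeff_X_pow, -map_sub, -map_mul] at h4
    exact hab (by exact_mod_cast (sub_eq_zero.1 h4).symm)
  refine (p.rootSet_finite ℂ).subset fun z hz => ?_
  rw [Polynomial.mem_rootSet]
  refine ⟨hp, ?_⟩
  rw [← hz, denom]
  simp [p]

lemma totalCurvature_surface {a b : ℝ} {σ : ℂ} (ha : a ≠ 1) (hb : b ≠ 1) (hab : a ≠ b)
    (hneg : sigmaSq a b < 0) (hσ : σ ^ 2 = ((sigmaSq a b : ℝ) : ℂ)) :
    HasFiniteTotalCurvature (surface a b σ) domain ∧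
      totalCurvature (surface a b σ) domain = -(16 * Real.pi) := by
  have hσ0 : σ ≠ 0 := by
    rintro rfl
    rw [zero_pow two_ne_zero] at hσ
    exact hneg.ne (by exact_mod_cast hσ.symm)
  have hX := isSpinorSurface_surface ha hb hneg hσ
  set P := leftSpinor a b with hPdef
  set Q := rightSpinor a b σ with hQdef
  set k : ℂ → ℝ := fun z => 4 * Complex.normSq (spinorWronskian P Q z) / spinorNorm P Q z ^ 2
    with hk
  have hm : MeasurableSet domain := isOpen_domain.measurableSet
  have hk0 : ∀ z, 0 ≤ k z := fun z =>
    div_nonneg (mul_nonneg zero_le_four (Complex.normSq_nonneg _)) (sq_nonneg _)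
  have hkc : ContinuousOn k domain := by
    have c1 := hX.left.continuousOn
    have c2 := hX.right.continuousOn
    have c3 := (hX.left.deriv isOpen_domain).continuousOn
    have c4 := (hX.right.deriv isOpen_domain).continuousOn
    have cW : ContinuousOn (spinorWronskian P Q) domain := (c3.mul c2).sub (c1.mul c4)
    have cS : ContinuousOn (spinorNorm P Q) domain :=
      (Complex.continuous_normSq.comp_continuousOn c1).add
        (Complex.continuous_normSq.comp_continuousOn c2)
    exact (continuousOn_const.mul (Complex.continuous_normSq.comp_continuousOn cW)).div
      (cS.pow 2) fun z hz => pow_ne_zero _ (hX.spinorNorm_pos hz).ne'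
  have hlint : ∫⁻ z in domain, ENNReal.ofReal (k z) = ENNReal.ofReal (16 * Real.pi) := by
    have h1 := (hasAreaDegree_gaussFactorization ha hb hab hσ0).lintegral_eq
      fun w => ENNReal.ofReal (sphereDensity w)
    rw [lintegral_sphereDensity] at h1
    have h2 : ENNReal.ofReal (16 * Real.pi) = ((4 : ℕ) : ENNReal) * ENNReal.ofReal (4 * Real.pi) := by
      rw [← ENNReal.ofReal_natCast, ← ENNReal.ofReal_mul (by positivity)]
      congr 1
      push_cast
      ring
    have hdom : (domain : Set ℂ) =ᵐ[volume] univ := by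
      refine eventuallyEq_univ.2 ?_
      rw [domain_eq_compl]
      exact (Set.toFinite _).countable.ae_notMem volume
    rw [h2, ← h1, setLIntegral_congr hdom, setLIntegral_univ]
    refine lintegral_congr_ae ?_
    have hfin : {z : ℂ | z ^ 2 + 2 = 0}.Countable := by
      have := hasAreaDegree_sq.countable_fibre (-2)
      convert this using 1
      ext z
      simp [add_eq_zero_iff_eq_neg]
    filter_upwards [eventuallyEq_univ.1 hdom, (finite_denom_zeros hab).countable.ae_notMem volume,
      hfin.ae_notMem volume] with z hz hD h2'
    have hev : gaussFactorization a b σ =ᶠ[𝓝 z] fun w => Q w / P w := by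
      have n1 : ∀ᶠ w in 𝓝 z, denom a b w ≠ 0 :=
        (differentiable_denom a b).continuous.continuousAt.eventually_ne hD
      have n2 : ∀ᶠ w in 𝓝 z, w ^ 2 + 2 ≠ 0 :=
        ContinuousAt.eventually_ne (g := fun w : ℂ => w ^ 2 + 2) (by fun_prop) h2'
      filter_upwards [n1, n2, isOpen_domain.mem_nhds hz] with w w1 w2 w3
      rw [gaussFactorization_eq w1 w2, hPdef, hQdef, ← gData_eq_div w3, gData, mul_div_assoc]
    have hPz : P z ≠ 0 := by
      obtain ⟨z0, z1⟩ := (mem_domain_iff z).1 hz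
      exact div_ne_zero hD (mul_ne_zero z0 z1)
    have hnhds := isOpen_domain.mem_nhds hz
    simp only [hk]
    rw [curvature_integrand_eq (hX.left.differentiableAt hnhds) (hX.right.differentiableAt hnhds)
      hPz, hev.deriv_eq, hev.eq_of_nhds, ENNReal.ofReal_mul (Complex.normSq_nonneg _)]
  have hcongr : EqOn (curvatureDensity (surface a b σ)) (fun z => -k z) domain := fun z hz =>
    hX.curvatureDensity_eq hz
  have hmeas : AEStronglyMeasurable k (volume.restrict domain) := hkc.aestronglyMeasurable hm
  have hint : IntegrableOn k domain := by
    refine ⟨hmeas, ?_⟩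
    rw [hasFiniteIntegral_iff_ofReal (ae_of_all _ hk0), hlint]
    exact ENNReal.ofReal_lt_top
  refine ⟨(integrableOn_congr_fun hcongr hm).2 hint.neg, ?_⟩
  rw [totalCurvature, setIntegral_congr_fun hm hcongr, integral_neg,
    integral_eq_lintegral_of_nonneg_ae (ae_of_all _ hk0) hmeas, hlint,
    ENNReal.toReal_ofReal (by positivity)]

end MinimalSurface
end

/-! ### Value distribution of `g`, Weierstrass data and uniqueness -/

noncomputable section
namespace MinimalSurface
open Set Filter Topology

/-- The biquadratic polynomials spanned by `z⁴` and `z² + 1`. -/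
def pencil (α β z : ℂ) : ℂ := α * z ^ 4 + β * (z ^ 2 + 1)

lemma hasDerivAt_pencil (α β z : ℂ) :
    HasDerivAt (pencil α β) (4 * α * z ^ 3 + 2 * β * z) z := by
  refine (((hasDerivAt_pow 4 z).const_mul α).add
    (((hasDerivAt_pow 2 z).add_const 1).const_mul β)).congr_deriv ?_
  push_cast
  ring

lemma analyticAt_pencil (α β z : ℂ) : AnalyticAt ℂ (pencil α β) z :=
  Differentiable.analyticAt (fun w => (hasDerivAt_pencil α β w).differentiableAt) z

/-- Solve a quadratic in `z²`. The root avoids `0` since `β ≠ 0`, and `±i` since `α ≠ 0`. -/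
lemma exists_root_pencil {α β : ℂ} (hα : α ≠ 0) (hβ : β ≠ 0) :
    ∃ p ∈ domain, pencil α β p = 0 := by
  obtain ⟨s, hs⟩ := IsAlgClosed.exists_pow_nat_eq (β ^ 2 - 4 * α * β) two_pos
  obtain ⟨p, hp⟩ := IsAlgClosed.exists_pow_nat_eq ((-β + s) / (2 * α)) two_pos
  have h0 : pencil α β p = 0 := by
    have h1 : 2 * α * p ^ 2 = -β + s := by
      rw [hp]
      field_simp
    have h2 : 4 * α * pencil α β p = 0 := by
      rw [pencil]
      linear_combination (2 * α * p ^ 2 + β + s) * h1 + hs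
    exact (mul_eq_zero.1 h2).resolve_left (mul_ne_zero (by norm_num) hα)
  refine ⟨p, (mem_domain_iff p).2 ⟨?_, ?_⟩, h0⟩
  · rintro rfl
    simp [pencil, hβ] at h0
  · intro h
    rw [pencil, h, mul_zero, add_zero, mul_eq_zero, or_iff_right hα] at h0
    rw [pow_eq_zero_iff four_ne_zero] at h0
    simp [h0] at h

/-- A multiple root away from `0` forces `p² = -2` and `β = 4α`, the case in which the pencil is
`α(z²+2)²`. -/
lemma analyticOrderAt_pencil_eq_one {α β p : ℂ} (hα : α ≠ 0) (hne : β ≠ 4 * α)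
    (hp : p ∈ domain) (h0 : pencil α β p = 0) : analyticOrderAt (pencil α β) p = 1 := by
  refine (analyticAt_pencil α β p).analyticOrderAt_eq_one_of_zero_deriv_ne_zero h0 ?_
  rw [(hasDerivAt_pencil α β p).deriv]
  intro h
  have hp0 := ((mem_domain_iff p).1 hp).1
  have h1 : β = -2 * α * p ^ 2 := by
    have : p * (β + 2 * α * p ^ 2) = 0 := by linear_combination h / 2
    linear_combination (mul_eq_zero.1 this).resolve_left hp0
  have h2 : p ^ 2 * α * (p ^ 2 + 2) = 0 := by
    rw [pencil, h1] at h0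
    linear_combination -h0
  have h3 := (mul_eq_zero.1 h2).resolve_left (mul_ne_zero (pow_ne_zero 2 hp0) hα)
  exact hne (by linear_combination h1 - 2 * α * h3)

lemma denom_eq_pencil (a b : ℝ) : denom a b = pencil (b - a) (4 * (b - 1)) := by
  funext z
  rw [denom_eq, pencil]

lemma numer_sub_eq_pencil (a b : ℝ) (c z : ℂ) :
    numer a b z - c * denom a b z = pencil ((b - a) * (1 - c)) (4 * (b - 1) * (a - c)) z := by
  rw [denom_eq, numer_eq, pencil]
  ring

lemma valueMult_coe_of_analyticAt {f : ℂ → ℂ} {p : ℂ} (hf : AnalyticAt ℂ f p) (c : ℂ) :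
    valueMult f (c : OnePoint ℂ) p = analyticOrderAt (fun z => f z - c) p := by
  have ha : AnalyticAt ℂ (fun z => f z - c) p := hf.sub analyticAt_const
  change (WithTop.map Int.toNat (meromorphicOrderAt (fun z => f z - c) p) : ℕ∞) = _
  rw [ha.meromorphicOrderAt_eq]
  cases analyticOrderAt (fun z => f z - c) p <;> rfl

lemma valueMult_infty (f : ℂ → ℂ) (p : ℂ) :
    valueMult f OnePoint.infty p = (((-(meromorphicOrderAt f p).untop₀).toNat : ℕ) : ℕ∞) := rfl

section gauss

variable {a b : ℝ} {σ : ℂ} {p : ℂ}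

lemma analyticAt_gData (hD : denom a b p ≠ 0) : AnalyticAt ℂ (gData a b σ) p :=
  analyticAt_const.mul (((differentiable_numer a b).analyticAt p).div
    ((differentiable_denom a b).analyticAt p) hD)

lemma valueMult_gData_of_denom_ne_zero (hσ : σ ≠ 0) (hD : denom a b p ≠ 0) (c : ℂ) :
    valueMult (gData a b σ) ((σ * c : ℂ) : OnePoint ℂ) p =
      analyticOrderAt (pencil ((b - a) * (1 - c)) (4 * (b - 1) * (a - c))) p := by
  rw [valueMult_coe_of_analyticAt (analyticAt_gData hD)]
  have hu : AnalyticAt ℂ (fun z => σ / denom a b z) p :=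
    analyticAt_const.div ((differentiable_denom a b).analyticAt p) hD
  have he : (fun z => gData a b σ z - σ * c) =ᶠ[𝓝 p] (fun z => σ / denom a b z) *
      pencil ((b - a) * (1 - c)) (4 * (b - 1) * (a - c)) := by
    filter_upwards [(differentiable_denom a b).continuous.continuousAt.eventually_ne hD] with z hz
    rw [Pi.mul_apply, ← numer_sub_eq_pencil, gData]
    field_simp
  rw [analyticOrderAt_congr he, analyticOrderAt_mul hu (analyticAt_pencil _ _ _),
    hu.analyticOrderAt_eq_zero.2 (div_ne_zero hσ hD), zero_add]

/-- Zeros of the denominator are simple, since `4(b-1) = 4(b-a)` would force `a = 1`, and the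
numerator does not vanish there; subtracting a constant leaves a simple pole simple. -/
lemma meromorphicOrderAt_gData_sub (ha : a ≠ 1) (hb : b ≠ 1) (hab : a ≠ b) (hσ : σ ≠ 0)
    (hp : p ∈ domain) (hD : denom a b p = 0) (c : ℂ) :
    meromorphicOrderAt (fun z => gData a b σ z - c) p = -1 := by
  have hab' : (b : ℂ) - a ≠ 0 := by exact_mod_cast sub_ne_zero.2 hab.symm
  have hN : numer a b p ≠ 0 := fun h => numer_denom_no_common_zero ha hb hp hD h
  have o1 : meromorphicOrderAt (denom a b) p = 1 := by
    rw [((differentiable_denom a b).analyticAt p).meromorphicOrderAt_eq]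
    rw [denom_eq_pencil] at hD ⊢
    rw [analyticOrderAt_pencil_eq_one hab' ?_ hp hD]
    · rfl
    · intro h
      apply ha
      have : (a : ℂ) = 1 := by linear_combination h / 4
      exact_mod_cast this
  have hu : AnalyticAt ℂ (fun z => σ * numer a b z - c * denom a b z) p :=
    (analyticAt_const.mul ((differentiable_numer a b).analyticAt p)).sub
      (analyticAt_const.mul ((differentiable_denom a b).analyticAt p))
  have o2 : meromorphicOrderAt (fun z => σ * numer a b z - c * denom a b z) p = 0 := by
    rw [hu.meromorphicOrderAt_eq, hu.analyticOrderAt_eq_zero.2]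
    · rfl
    · rw [hD, mul_zero, sub_zero]
      exact mul_ne_zero hσ hN
  have hm : MeromorphicAt (denom a b) p := ((differentiable_denom a b).analyticAt p).meromorphicAt
  have hev : ∀ᶠ z in 𝓝[≠] p, denom a b z ≠ 0 := by
    rw [← meromorphicOrderAt_ne_top_iff_eventually_ne_zero hm, o1]
    exact WithTop.one_ne_top
  have he : (fun z => gData a b σ z - c) =ᶠ[𝓝[≠] p]
      (fun z => σ * numer a b z - c * denom a b z) * (denom a b)⁻¹ := by
    filter_upwards [hev] with z hz
    rw [Pi.mul_apply, Pi.inv_apply, gData]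
    field_simp
  rw [meromorphicOrderAt_congr he, meromorphicOrderAt_mul hu.meromorphicAt hm.inv, o2,
    meromorphicOrderAt_inv, o1, zero_add]

lemma valueMult_gData_infty_of_denom_eq_zero (ha : a ≠ 1) (hb : b ≠ 1) (hab : a ≠ b) (hσ : σ ≠ 0)
    (hp : p ∈ domain) (hD : denom a b p = 0) :
    valueMult (gData a b σ) OnePoint.infty p = 1 := by
  have h := meromorphicOrderAt_gData_sub ha hb hab hσ hp hD 0
  simp only [sub_zero] at h
  rw [valueMult_infty, h]
  rfl

lemma valueMult_gData_coe_of_denom_eq_zero (ha : a ≠ 1) (hb : b ≠ 1) (hab : a ≠ b) (hσ : σ ≠ 0)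
    (hp : p ∈ domain) (hD : denom a b p = 0) (c : ℂ) :
    valueMult (gData a b σ) (c : OnePoint ℂ) p = 0 := by
  change WithTop.map Int.toNat (meromorphicOrderAt (fun z => gData a b σ z - c) p) = 0
  rw [meromorphicOrderAt_gData_sub ha hb hab hσ hp hD c]
  rfl

lemma takesValueAt_gData_iff (ha : a ≠ 1) (hb : b ≠ 1) (hab : a ≠ b) (hσ : σ ≠ 0)
    (hp : p ∈ domain) (c : ℂ) :
    TakesValueAt (gData a b σ) ((σ * c : ℂ) : OnePoint ℂ) p ↔
      pencil ((b - a) * (1 - c)) (4 * (b - 1) * (a - c)) p = 0 := by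
  rw [TakesValueAt]
  by_cases hD : denom a b p = 0
  · rw [valueMult_gData_coe_of_denom_eq_zero ha hb hab hσ hp hD, ← numer_sub_eq_pencil, hD]
    simp only [ne_eq, not_true_eq_false, mul_zero, sub_zero, false_iff]
    exact fun h => numer_denom_no_common_zero ha hb hp hD h
  · rw [valueMult_gData_of_denom_ne_zero hσ hD, (analyticAt_pencil _ _ _).analyticOrderAt_ne_zero]

lemma denom_ne_zero_of_pencil (ha : a ≠ 1) (hb : b ≠ 1) (hp : p ∈ domain) {c : ℂ}
    (h : pencil ((b - a) * (1 - c)) (4 * (b - 1) * (a - c)) p = 0) : denom a b p ≠ 0 := by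
  intro hD
  rw [← numer_sub_eq_pencil, hD, mul_zero, sub_zero] at h
  exact numer_denom_no_common_zero ha hb hp hD h

lemma exists_valueMult_eq_one (ha : a ≠ 1) (hb : b ≠ 1) (hab : a ≠ b) (hσ : σ ≠ 0)
    {v : OnePoint ℂ} (h1 : v ≠ ((σ : ℂ) : OnePoint ℂ)) (h2 : v ≠ ((σ * a : ℂ) : OnePoint ℂ))
    (h3 : v ≠ ((σ * b : ℂ) : OnePoint ℂ)) :
    ∃ p ∈ domain, valueMult (gData a b σ) v p = 1 := by
  have ha' : (a : ℂ) - 1 ≠ 0 := by exact_mod_cast sub_ne_zero.2 ha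
  have hb' : (b : ℂ) - 1 ≠ 0 := by exact_mod_cast sub_ne_zero.2 hb
  have hab' : (b : ℂ) - a ≠ 0 := by exact_mod_cast sub_ne_zero.2 hab.symm
  induction v using OnePoint.rec with
  | infty =>
    obtain ⟨p, hp, h⟩ := exists_root_pencil hab' (mul_ne_zero (by norm_num : (4 : ℂ) ≠ 0) hb')
    rw [← denom_eq_pencil] at h
    exact ⟨p, hp, valueMult_gData_infty_of_denom_eq_zero ha hb hab hσ hp h⟩
  | coe v =>
    obtain ⟨c, rfl⟩ : ∃ c, v = σ * c := ⟨v / σ, by field_simp⟩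
    have k : ∀ x : ℂ, ((σ * c : ℂ) : OnePoint ℂ) ≠ ((σ * x : ℂ) : OnePoint ℂ) → x - c ≠ 0 :=
      fun x hx h => hx (by rw [sub_eq_zero.1 h])
    have c1 := k 1 (by rwa [mul_one])
    have ca := k a h2
    have cb := k b h3
    obtain ⟨p, hp, h⟩ := exists_root_pencil (mul_ne_zero hab' c1)
      (mul_ne_zero (mul_ne_zero (by norm_num : (4 : ℂ) ≠ 0) hb') ca)
    refine ⟨p, hp, ?_⟩
    rw [valueMult_gData_of_denom_ne_zero hσ (denom_ne_zero_of_pencil ha hb hp h),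
      analyticOrderAt_pencil_eq_one (mul_ne_zero hab' c1) ?_ hp h]
    -- For this member of the pencil, `β - 4α = 4(a-1)(b-c)`.
    intro hh
    exact mul_ne_zero ha' cb (by linear_combination hh / 4)

lemma not_takesValueAt_sigma (ha : a ≠ 1) (hb : b ≠ 1) (hab : a ≠ b) (hσ : σ ≠ 0)
    (hp : p ∈ domain) : ¬ TakesValueAt (gData a b σ) ((σ : ℂ) : OnePoint ℂ) p := by
  have ha' : (a : ℂ) - 1 ≠ 0 := by exact_mod_cast sub_ne_zero.2 ha
  have hb' : (b : ℂ) - 1 ≠ 0 := by exact_mod_cast sub_ne_zero.2 hb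
  have h := takesValueAt_gData_iff ha hb hab hσ hp 1
  rw [mul_one] at h
  rw [h]
  simp [pencil, ha', hb', ((mem_domain_iff p).1 hp).2]

lemma not_takesValueAt_sigma_mul (ha : a ≠ 1) (hb : b ≠ 1) (hab : a ≠ b) (hσ : σ ≠ 0)
    (hp : p ∈ domain) : ¬ TakesValueAt (gData a b σ) ((σ * a : ℂ) : OnePoint ℂ) p := by
  have ha' : 1 - (a : ℂ) ≠ 0 := by exact_mod_cast sub_ne_zero.2 ha.symm
  have hab' : (b : ℂ) - a ≠ 0 := by exact_mod_cast sub_ne_zero.2 hab.symm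
  rw [takesValueAt_gData_iff ha hb hab hσ hp]
  simp [pencil, ha', hab', ((mem_domain_iff p).1 hp).1]

lemma valueMult_sigma_mul_b (ha : a ≠ 1) (hb : b ≠ 1) (hab : a ≠ b) (hσ : σ ≠ 0)
    (hp : p ∈ domain) (h : TakesValueAt (gData a b σ) ((σ * b : ℂ) : OnePoint ℂ) p) :
    valueMult (gData a b σ) ((σ * b : ℂ) : OnePoint ℂ) p = 2 := by
  have hb' : 1 - (b : ℂ) ≠ 0 := by exact_mod_cast sub_ne_zero.2 hb.symm
  have hab' : (b : ℂ) - a ≠ 0 := by exact_mod_cast sub_ne_zero.2 hab.symm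
  rw [takesValueAt_gData_iff ha hb hab hσ hp] at h
  rw [valueMult_gData_of_denom_ne_zero hσ (denom_ne_zero_of_pencil ha hb hp h)]
  -- For `c = b` one has `β = 4α`, and `z⁴ + 4z² + 4` is a square.
  have e : pencil ((b - a) * (1 - b)) (4 * (b - 1) * (a - b)) =
      (fun _ => ((b : ℂ) - a) * (1 - b)) * (fun z => z ^ 2 + 2) ^ 2 := by
    funext z
    simp only [pencil, Pi.mul_apply, Pi.pow_apply]
    ring
  rw [e] at h ⊢
  have hk := mul_ne_zero hab' hb'
  have h0 : p ^ 2 + 2 = 0 := by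
    have := (mul_eq_zero.1 h).resolve_left hk
    exact pow_eq_zero_iff two_ne_zero |>.1 this
  have han : AnalyticAt ℂ (fun z : ℂ => z ^ 2 + 2) p := by fun_prop
  have hd : HasDerivAt (fun z : ℂ => z ^ 2 + 2) (2 * p) p := by
    simpa using (hasDerivAt_pow 2 p).add_const 2
  have o1 : analyticOrderAt (fun z : ℂ => z ^ 2 + 2) p = 1 := by
    refine han.analyticOrderAt_eq_one_of_zero_deriv_ne_zero h0 ?_
    rw [hd.deriv]
    exact mul_ne_zero two_ne_zero ((mem_domain_iff p).1 hp).1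
  rw [analyticOrderAt_mul analyticAt_const (han.pow 2), analyticOrderAt_pow han, o1,
    analyticAt_const.analyticOrderAt_eq_zero.2 hk]
  simp

lemma exists_takesValueAt_sigma_mul_b (ha : a ≠ 1) (hb : b ≠ 1) (hab : a ≠ b) (hσ : σ ≠ 0) :
    ∃ p ∈ domain, TakesValueAt (gData a b σ) ((σ * b : ℂ) : OnePoint ℂ) p := by
  have hb' : 1 - (b : ℂ) ≠ 0 := by exact_mod_cast sub_ne_zero.2 hb.symm
  have hb'' : (b : ℂ) - 1 ≠ 0 := by exact_mod_cast sub_ne_zero.2 hb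
  have hab' : (b : ℂ) - a ≠ 0 := by exact_mod_cast sub_ne_zero.2 hab.symm
  have hab'' : (a : ℂ) - b ≠ 0 := by exact_mod_cast sub_ne_zero.2 hab
  obtain ⟨p, hp, h⟩ := exists_root_pencil (mul_ne_zero hab' hb')
    (mul_ne_zero (mul_ne_zero (by norm_num : (4 : ℂ) ≠ 0) hb'') hab'')
  exact ⟨p, hp, (takesValueAt_gData_iff ha hb hab hσ hp b).2 h⟩

lemma ramificationOrder_sigma (ha : a ≠ 1) (hb : b ≠ 1) (hab : a ≠ b) (hσ : σ ≠ 0) :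
    ramificationOrder (gData a b σ) domain ((σ : ℂ) : OnePoint ℂ) = ⊤ := by
  simp only [ramificationOrder, iInf_eq_top]
  exact fun p hp h => absurd h (not_takesValueAt_sigma ha hb hab hσ hp)

lemma ramificationOrder_sigma_mul (ha : a ≠ 1) (hb : b ≠ 1) (hab : a ≠ b) (hσ : σ ≠ 0) :
    ramificationOrder (gData a b σ) domain ((σ * a : ℂ) : OnePoint ℂ) = ⊤ := by
  simp only [ramificationOrder, iInf_eq_top]
  exact fun p hp h => absurd h (not_takesValueAt_sigma_mul ha hb hab hσ hp)

lemma ramificationOrder_sigma_mul_b (ha : a ≠ 1) (hb : b ≠ 1) (hab : a ≠ b) (hσ : σ ≠ 0) :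
    ramificationOrder (gData a b σ) domain ((σ * b : ℂ) : OnePoint ℂ) = 2 := by
  apply le_antisymm
  · obtain ⟨p, hp, h⟩ := exists_takesValueAt_sigma_mul_b ha hb hab hσ
    refine (iInf_le_of_le p (iInf_le_of_le hp (iInf_le_of_le h le_rfl))).trans_eq ?_
    exact valueMult_sigma_mul_b ha hb hab hσ hp h
  · exact le_iInf fun p => le_iInf fun hp => le_iInf fun h =>
      (valueMult_sigma_mul_b ha hb hab hσ hp h).ge

lemma ramificationOrder_le_one (ha : a ≠ 1) (hb : b ≠ 1) (hab : a ≠ b) (hσ : σ ≠ 0)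
    {v : OnePoint ℂ} (h1 : v ≠ ((σ : ℂ) : OnePoint ℂ)) (h2 : v ≠ ((σ * a : ℂ) : OnePoint ℂ))
    (h3 : v ≠ ((σ * b : ℂ) : OnePoint ℂ)) : ramificationOrder (gData a b σ) domain v ≤ 1 := by
  obtain ⟨p, hp, h⟩ := exists_valueMult_eq_one ha hb hab hσ h1 h2 h3
  have ht : TakesValueAt (gData a b σ) v p := by
    rw [TakesValueAt, h]
    exact one_ne_zero
  exact (iInf_le_of_le p (iInf_le_of_le hp (iInf_le_of_le ht le_rfl))).trans_eq h

lemma omittedValues_gData (ha : a ≠ 1) (hb : b ≠ 1) (hab : a ≠ b) (hσ : σ ≠ 0) :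
    omittedValues (gData a b σ) domain =
      {((σ : ℂ) : OnePoint ℂ), ((σ * a : ℂ) : OnePoint ℂ)} := by
  ext v
  constructor
  · intro hv
    by_contra hne
    simp only [mem_insert_iff, mem_singleton_iff, not_or] at hne
    by_cases hvb : v = ((σ * b : ℂ) : OnePoint ℂ)
    · obtain ⟨p, hp, h⟩ := exists_takesValueAt_sigma_mul_b ha hb hab hσ
      exact hv p hp (hvb ▸ h)
    · obtain ⟨p, hp, h⟩ := exists_valueMult_eq_one ha hb hab hσ hne.1 hne.2 hvb
      exact hv p hp (by rw [TakesValueAt, h]; exact one_ne_zero)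
  · rintro (rfl | rfl) p hp
    · exact not_takesValueAt_sigma ha hb hab hσ hp
    · exact not_takesValueAt_sigma_mul ha hb hab hσ hp

lemma totallyRamifiedValues_gData (ha : a ≠ 1) (hb : b ≠ 1) (hab : a ≠ b) (hσ : σ ≠ 0) :
    totallyRamifiedValues (gData a b σ) domain =
      {((σ : ℂ) : OnePoint ℂ), ((σ * a : ℂ) : OnePoint ℂ), ((σ * b : ℂ) : OnePoint ℂ)} := by
  ext v
  constructor
  · intro hv
    by_contra hne
    simp only [mem_insert_iff, mem_singleton_iff, not_or] at hne
    have h1 := ramificationOrder_le_one ha hb hab hσ hne.1 hne.2.1 hne.2.2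
    have h2 : (2 : ℕ∞) ≤ 1 := le_trans hv h1
    exact absurd h2 (by decide)
  · rintro (rfl | rfl | rfl)
    · exact (ramificationOrder_sigma ha hb hab hσ).ge.trans' le_top
    · exact (ramificationOrder_sigma_mul ha hb hab hσ).ge.trans' le_top
    · exact (ramificationOrder_sigma_mul_b ha hb hab hσ).ge

lemma sigma_ne_sigma_mul (ha : a ≠ 1) (hσ : σ ≠ 0) :
    ((σ : ℂ) : OnePoint ℂ) ≠ ((σ * a : ℂ) : OnePoint ℂ) := by
  rw [Ne, OnePoint.coe_eq_coe]
  intro h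
  apply ha
  have h' : (1 : ℂ) = a := mul_left_cancel₀ hσ (by rwa [mul_one])
  exact_mod_cast h'.symm

lemma sigma_mul_ne_sigma_mul (hab : a ≠ b) (hσ : σ ≠ 0) :
    ((σ * a : ℂ) : OnePoint ℂ) ≠ ((σ * b : ℂ) : OnePoint ℂ) := by
  rw [Ne, OnePoint.coe_eq_coe]
  intro h
  exact hab (by exact_mod_cast mul_left_cancel₀ hσ h)

lemma totallyRamifiedValues_diff (ha : a ≠ 1) (hb : b ≠ 1) (hab : a ≠ b) (hσ : σ ≠ 0) :
    totallyRamifiedValues (gData a b σ) domain \ omittedValues (gData a b σ) domain =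
      {((σ * b : ℂ) : OnePoint ℂ)} := by
  rw [totallyRamifiedValues_gData ha hb hab hσ, omittedValues_gData ha hb hab hσ]
  have h1 := sigma_ne_sigma_mul hb hσ
  have h2 := sigma_mul_ne_sigma_mul hab hσ
  ext v
  simp only [Set.mem_sdiff, mem_insert_iff, mem_singleton_iff, not_or]
  constructor
  · rintro ⟨h | h | h, n1, n2⟩
    · exact absurd h n1
    · exact absurd h n2
    · exact h
  · rintro rfl
    exact ⟨Or.inr (Or.inr rfl), h1.symm, h2.symm⟩

open Classical in
lemma totalWeight_gData (ha : a ≠ 1) (hb : b ≠ 1) (hab : a ≠ b) (hσ : σ ≠ 0) :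
    totalWeight (gData a b σ) domain = 5 / 2 := by
  have h0 := sigma_ne_sigma_mul ha hσ
  have h1 := sigma_ne_sigma_mul hb hσ
  have h2 := sigma_mul_ne_sigma_mul hab hσ
  have hS : totallyRamifiedValues (gData a b σ) domain =
      (({((σ : ℂ) : OnePoint ℂ), ((σ * a : ℂ) : OnePoint ℂ),
        ((σ * b : ℂ) : OnePoint ℂ)} : Finset (OnePoint ℂ)) : Set (OnePoint ℂ)) := by
    rw [totallyRamifiedValues_gData ha hb hab hσ]
    simp
  rw [totalWeight, hS, Finset.tsum_subtype' _
    fun v => (1 - ((ramificationOrder (gData a b σ) domain v : ℕ∞) : ENNReal)⁻¹),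
    Finset.sum_insert (by simp only [Finset.mem_insert, Finset.mem_singleton, not_or]; exact ⟨h0, h1⟩),
    Finset.sum_insert (by simp only [Finset.mem_singleton]; exact h2), Finset.sum_singleton,
    ramificationOrder_sigma ha hb hab hσ, ramificationOrder_sigma_mul ha hb hab hσ,
    ramificationOrder_sigma_mul_b ha hb hab hσ]
  have e : ((2 : ℕ∞) : ENNReal) = 2 := rfl
  rw [e, ENat.toENNReal_top, ENNReal.inv_top, tsub_zero, ENNReal.one_sub_inv_two,
    ENNReal.eq_div_iff two_ne_zero ENNReal.ofNat_ne_top, mul_add, mul_add,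
    ENNReal.mul_inv_cancel two_ne_zero ENNReal.ofNat_ne_top]
  norm_num

lemma takesValueAt_gaussMap (ha : a ≠ 1) (hb : b ≠ 1) (hab : a ≠ b) (hσ : σ ≠ 0) {X : ℂ → E3}
    (hX : IsSpinorSurface X domain (leftSpinor a b) (rightSpinor a b σ)) (hp : p ∈ domain) :
    TakesValueAt (gData a b σ) (gaussMap X p) p := by
  obtain ⟨z0, z1⟩ := (mem_domain_iff p).1 hp
  by_cases hD : denom a b p = 0
  · rw [hX.gaussMap_of_eq_zero hp (by rw [leftSpinor, hD, zero_div]), TakesValueAt,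
      valueMult_gData_infty_of_denom_eq_zero ha hb hab hσ hp hD]
    exact one_ne_zero
  · rw [hX.gaussMap_of_ne_zero hp (div_ne_zero hD (mul_ne_zero z0 z1)), ← gData_eq_div hp,
      TakesValueAt, valueMult_coe_of_analyticAt (analyticAt_gData hD)]
    have han : AnalyticAt ℂ (fun z => gData a b σ z - gData a b σ p) p :=
      (analyticAt_gData hD).sub analyticAt_const
    rw [han.analyticOrderAt_ne_zero, sub_self]

lemma hasWeierstrassData_of_isSpinorSurface (ha : a ≠ 1) (hb : b ≠ 1) (hab : a ≠ b) (hσ : σ ≠ 0)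
    {X : ℂ → E3} (hX : IsSpinorSurface X domain (leftSpinor a b) (rightSpinor a b σ)) :
    HasWeierstrassData X domain (gData a b σ) (hData a b) where
  holomorphic := (hX.left.pow 2).congr fun z _ => hData_eq a b z
  meromorphic := fun z _ => (MeromorphicAt.const σ z).mul
    (((differentiable_numer a b).analyticAt z).meromorphicAt.div
      ((differentiable_denom a b).analyticAt z).meromorphicAt)
  h_eq := fun z hz => by rw [hX.phi_zero_sub hz, hData_eq]
  g_eq := fun z hz h => by
    rw [hData_eq] at h ⊢
    have h0 : leftSpinor a b z ≠ 0 := fun hh => h (by rw [hh, zero_pow two_ne_zero])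
    rw [hX.phi_two hz, gData_eq_div hz]
    field_simp
  g_pole := fun z hz h => by
    obtain ⟨z0, z1⟩ := (mem_domain_iff z).1 hz
    have hD : denom a b z = 0 := by
      rw [hData_eq, pow_eq_zero_iff two_ne_zero, leftSpinor, div_eq_zero_iff,
        or_iff_left (mul_ne_zero z0 z1)] at h
      exact h
    have := meromorphicOrderAt_gData_sub ha hb hab hσ hz hD 0
    simp only [sub_zero] at this
    change meromorphicOrderAt (fun z => gData a b σ z) z < 0
    rw [this]
    decide

lemma domain_subset_closure (hab : a ≠ b) :
    domain ⊆ closure {z ∈ domain | leftSpinor a b z ≠ 0} := by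
  have hd : Dense ({z : ℂ | denom a b z = 0}ᶜ ∩ domain) := by
    rw [domain_eq_compl, ← compl_union]
    exact ((finite_denom_zeros hab).union (Set.toFinite _)).countable.dense_compl ℂ
  intro z _
  refine closure_mono ?_ (hd z)
  rintro w ⟨hw, hw'⟩
  obtain ⟨z0, z1⟩ := (mem_domain_iff w).1 hw'
  exact ⟨hw', div_ne_zero hw (mul_ne_zero z0 z1)⟩

lemma unique_up_to_translation (hab : a ≠ b) {X : ℂ → E3}
    (hX : IsSpinorSurface X domain (leftSpinor a b) (rightSpinor a b σ)) {X' : ℂ → E3}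
    (hm : IsMinimalSurface X' domain)
    (hw : HasWeierstrassData X' domain (gData a b σ) (hData a b)) :
    ∃ c : E3, ∀ z ∈ domain, X' z = X z + c := by
  refine hX.eq_add_const isPreconnected_domain (domain_subset_closure hab) hm (fun z hz => ?_)
    fun z hz h0 => ?_
  · rw [← hw.h_eq z hz, hData_eq]
  · have hh : hData a b z ≠ 0 := by
      rw [hData_eq]
      exact pow_ne_zero 2 h0
    have := hw.g_eq z hz hh
    rw [gData_eq_div hz, hData_eq] at this
    field_simp at this
    rw [← this]
    ring

end gauss

end MinimalSurface
end

/-! ### Counting ends: the domains are not homeomorphic -/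

noncomputable section
namespace MinimalSurface
open Set Filter Topology

/-- Counting ends: a space all of whose compact sets have complements covered, up to relatively
compact sets, by preconnected sets indexed by `κ`, has at most `card κ` ends. -/
lemma card_le_card_of_ends {X Y ι κ : Type*} [TopologicalSpace X] [TopologicalSpace Y] [Fintype ι]
    [Fintype κ] (ψ : X ≃ₜ Y) (U : ι → Set Y) (hU : ∀ i, IsOpen (U i))
    (hdisj : Pairwise fun i j => Disjoint (U i) (U j)) (hK : IsCompact (⋃ i, U i)ᶜ)
    (hend : ∀ i, ∀ C : Set Y, IsCompact C → ¬ U i ⊆ C)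
    (hX : ∀ K : Set X, IsCompact K → ∃ V : κ → Set X, (∀ j, IsPreconnected (V j)) ∧
      (∀ j, Disjoint (V j) K) ∧ IsCompact (⋃ j, V j)ᶜ) :
    Fintype.card ι ≤ Fintype.card κ := by
  -- The compact set removed is the preimage of the complement of the `U i`, so each `ψ '' V j` lies
  -- in their union and, being preconnected, in a single one.
  obtain ⟨V, hV, hVK, hVc⟩ := hX _ (ψ.isCompact_preimage.2 hK)
  have key : ∀ i, ∃ j, ∃ x ∈ V j, ψ x ∈ U i := by
    intro i
    obtain ⟨y, hy, hyC⟩ := not_subset.1 (hend i _ (ψ.isCompact_image.2 hVc))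
    have : ψ.symm y ∈ ⋃ j, V j := by
      by_contra h
      exact hyC ⟨ψ.symm y, h, ψ.apply_symm_apply y⟩
    obtain ⟨j, hj⟩ := mem_iUnion.1 this
    exact ⟨j, _, hj, by rwa [ψ.apply_symm_apply]⟩
  choose f x hxV hxU using key
  -- Every `U i` meets some `ψ '' V (f i)`. If two indices shared the same `V`, its image would lie
  -- in one `U i` and meet a disjoint one.
  refine Fintype.card_le_of_injective f fun i i' hii => ?_
  by_contra hne
  have hp : IsPreconnected (ψ '' V (f i)) := (hV _).image _ ψ.continuous.continuousOn
  have hsub : ψ '' V (f i) ⊆ U i ∪ ⋃ k ∈ {k | k ≠ i}, U k := by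
    rintro _ ⟨z, hz, rfl⟩
    have : ψ z ∈ ⋃ k, U k := by
      by_contra h
      exact Set.disjoint_left.1 (hVK _) hz h
    obtain ⟨k, hk⟩ := mem_iUnion.1 this
    by_cases hki : k = i
    · exact Or.inl (hki ▸ hk)
    · exact Or.inr (mem_biUnion hki hk)
  have hle := hp.subset_left_of_subset_union (hU i) (isOpen_biUnion fun k _ => hU k)
    (disjoint_iUnion₂_right.2 fun k hk => hdisj (Ne.symm hk)) hsub
    ⟨ψ (x i), ⟨mem_image_of_mem _ (hxV i), hxU i⟩⟩
  have h1 : ψ (x i') ∈ U i := hle (mem_image_of_mem _ (hii ▸ hxV i'))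
  exact Set.disjoint_left.1 (hdisj hne) h1 (hxU i')

/-- A punctured disk. -/
def puncturedBall (c : ℂ) (r : ℝ) : Set ℂ := {z | z ≠ c ∧ ‖z - c‖ < r}

/-- A punctured neighbourhood of infinity. -/
def outerDomain (r : ℝ) : Set ℂ := {z | r < ‖z‖}

lemma isOpen_puncturedBall (c : ℂ) (r : ℝ) : IsOpen (puncturedBall c r) :=
  isOpen_ne.inter (isOpen_lt (f := fun z : ℂ => ‖z - c‖) (by fun_prop) continuous_const)

lemma isOpen_outerDomain (r : ℝ) : IsOpen (outerDomain r) :=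
  isOpen_lt continuous_const continuous_norm

/-- A punctured disk is a translate of the exponential image of a half-plane, which is convex. -/
lemma isPreconnected_puncturedBall (c : ℂ) {r : ℝ} (hr : 0 < r) :
    IsPreconnected (puncturedBall c r) := by
  have h : puncturedBall c r = (fun w => c + Complex.exp w) '' {w | w.re < Real.log r} := by
    ext z
    constructor
    · rintro ⟨h1, h2⟩
      have h3 : z - c ≠ 0 := sub_ne_zero.2 h1
      refine ⟨Complex.log (z - c), ?_, ?_⟩
      · change (Complex.log (z - c)).re < Real.log r
        rw [Complex.log_re]
        exact Real.log_lt_log (norm_pos_iff.2 h3) h2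
      · simp only [Complex.exp_log h3]
        ring
    · rintro ⟨w, hw, rfl⟩
      refine ⟨by simp [Complex.exp_ne_zero], ?_⟩
      rw [add_sub_cancel_left, Complex.norm_exp]
      exact (Real.lt_log_iff_exp_lt hr).1 hw
  rw [h]
  exact (convex_halfSpace_re_lt _).isPreconnected.image _ (by fun_prop)

lemma isPreconnected_outerDomain {r : ℝ} (hr : 0 < r) : IsPreconnected (outerDomain r) := by
  have h : outerDomain r = Complex.exp '' {w | Real.log r < w.re} := by
    ext z
    constructor
    · intro h1
      have h1' : r < ‖z‖ := h1
      have h3 : z ≠ 0 := norm_pos_iff.1 (hr.trans h1')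
      refine ⟨Complex.log z, ?_, Complex.exp_log h3⟩
      change Real.log r < (Complex.log z).re
      rw [Complex.log_re]
      exact Real.log_lt_log hr h1'
    · rintro ⟨w, hw, rfl⟩
      change r < ‖Complex.exp w‖
      rw [Complex.norm_exp]
      exact (Real.log_lt_iff_lt_exp hr).1 hw
  rw [h]
  exact (convex_halfSpace_re_gt _).isPreconnected.image _ (by fun_prop)

lemma exists_forall_le_norm_sub {Ω : Set ℂ} {C : Set Ω} (hC : IsCompact C) {c : ℂ} (hc : c ∉ Ω) :
    ∃ ε > 0, ∀ z ∈ C, ε ≤ ‖(z : ℂ) - c‖ := by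
  have h1 : IsClosed (Subtype.val '' C) := (hC.image continuous_subtype_val).isClosed
  have h2 : c ∈ (Subtype.val '' C)ᶜ := by
    rintro ⟨z, -, rfl⟩
    exact hc z.2
  obtain ⟨ε, hε, h⟩ := Metric.isOpen_iff.1 h1.isOpen_compl c h2
  refine ⟨ε, hε, fun z hz => ?_⟩
  by_contra! hlt
  exact h (by simpa [dist_eq_norm] using hlt) (mem_image_of_mem _ hz)

lemma exists_forall_norm_le {Ω : Set ℂ} {C : Set Ω} (hC : IsCompact C) :
    ∃ R > 0, ∀ z ∈ C, ‖(z : ℂ)‖ ≤ R := by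
  obtain ⟨R, hR, h⟩ := (hC.image continuous_subtype_val).isBounded.exists_pos_norm_le
  exact ⟨R, hR, fun z hz => h _ (mem_image_of_mem _ hz)⟩

lemma isPreconnected_preimage_val {Ω s : Set ℂ} (hs : IsPreconnected s) (h : s ⊆ Ω) :
    IsPreconnected (Subtype.val ⁻¹' s : Set Ω) := by
  rw [← Topology.IsInducing.subtypeVal.isPreconnected_image, Subtype.image_preimage_coe,
    inter_eq_right.2 h]
  exact hs

lemma isCompact_of_bounds {Ω : Set ℂ} (S : Set Ω) {R : ℝ} {F : Set ℂ} (hF : IsClosed F)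
    (hFΩ : F ⊆ Ω) (hR : ∀ z ∈ F, ‖z‖ ≤ R) (hS : S = Subtype.val ⁻¹' F) : IsCompact S := by
  rw [Subtype.isCompact_iff, hS, Subtype.image_preimage_coe, inter_eq_right.2 hFΩ]
  exact (isCompact_closedBall (0 : ℂ) R).of_isClosed_subset hF fun z hz => by simpa using hR z hz

lemma not_puncturedBall_subset {Ω : Set ℂ} {C : Set Ω} (hC : IsCompact C) {c : ℂ} {r : ℝ}
    (hr : 0 < r) (hc : c ∉ Ω) (hsub : puncturedBall c r ⊆ Ω) :
    ¬ (Subtype.val ⁻¹' puncturedBall c r : Set Ω) ⊆ C := by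
  intro h
  obtain ⟨ε, hε, hle⟩ := exists_forall_le_norm_sub hC hc
  set t := min ε r / 2 with ht
  have ht0 : 0 < t := half_pos (lt_min hε hr)
  have hn : ‖c + (t : ℂ) - c‖ = t := by
    rw [add_sub_cancel_left, Complex.norm_real, Real.norm_of_nonneg ht0.le]
  have hz : c + (t : ℂ) ∈ puncturedBall c r := by
    refine ⟨by simpa using ht0.ne', ?_⟩
    rw [hn]
    linarith [min_le_right ε r]
  have := hle ⟨_, hsub hz⟩ (h hz)
  rw [hn] at this
  linarith [min_le_left ε r]

lemma not_outerDomain_subset {Ω : Set ℂ} {C : Set Ω} (hC : IsCompact C) {r : ℝ}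
    (hr : 0 < r) (hsub : outerDomain r ⊆ Ω) :
    ¬ (Subtype.val ⁻¹' outerDomain r : Set Ω) ⊆ C := by
  intro h
  obtain ⟨R, hR, hle⟩ := exists_forall_norm_le hC
  have hn : ‖((r + R : ℝ) : ℂ)‖ = r + R := by
    rw [Complex.norm_real, Real.norm_of_nonneg (by positivity)]
  have hz : ((r + R : ℝ) : ℂ) ∈ outerDomain r := by
    change r < ‖((r + R : ℝ) : ℂ)‖
    rw [hn]
    linarith
  have := hle ⟨_, hsub hz⟩ (h hz)
  rw [hn] at this
  linarith

lemma disjoint_puncturedBall {c c' : ℂ} (h : 1 ≤ ‖c - c'‖) :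
    Disjoint (puncturedBall c (1 / 2)) (puncturedBall c' (1 / 2)) := by
  rw [Set.disjoint_left]
  rintro z ⟨-, h1⟩ ⟨-, h2⟩
  have := norm_sub_le (z - c') (z - c)
  rw [sub_sub_sub_cancel_left] at this
  linarith

lemma disjoint_puncturedBall_outerDomain {c : ℂ} (h : ‖c‖ ≤ 1) :
    Disjoint (puncturedBall c (1 / 2)) (outerDomain 2) := by
  rw [Set.disjoint_left]
  rintro z ⟨-, h1⟩ h2
  have h2' : 2 < ‖z‖ := h2
  have := norm_add_le (z - c) c
  rw [sub_add_cancel] at this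
  linarith

/-- Neighbourhoods of the four ends of the domain. -/
def fourEnds : Fin 4 → Set ℂ :=
  ![puncturedBall 0 (1 / 2), puncturedBall Complex.I (1 / 2), puncturedBall (-Complex.I) (1 / 2),
    outerDomain 2]

lemma norm_two_I : ‖Complex.I - -Complex.I‖ = 2 := by
  rw [sub_neg_eq_add, ← two_mul]
  simp

lemma pairwise_disjoint_fourEnds : Pairwise fun i j => Disjoint (fourEnds i) (fourEnds j) := by
  have h01 : Disjoint (fourEnds 0) (fourEnds 1) := disjoint_puncturedBall (by simp)
  have h02 : Disjoint (fourEnds 0) (fourEnds 2) := disjoint_puncturedBall (by simp)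
  have h03 : Disjoint (fourEnds 0) (fourEnds 3) := disjoint_puncturedBall_outerDomain (by simp)
  have h12 : Disjoint (fourEnds 1) (fourEnds 2) :=
    disjoint_puncturedBall (by rw [norm_two_I]; norm_num)
  have h13 : Disjoint (fourEnds 1) (fourEnds 3) := disjoint_puncturedBall_outerDomain (by simp)
  have h23 : Disjoint (fourEnds 2) (fourEnds 3) := disjoint_puncturedBall_outerDomain (by simp)
  intro i j hij
  fin_cases i <;> fin_cases j <;> first | exact absurd rfl hij | assumption | (symm; assumption)

lemma puncturedBall_subset_domain {c : ℂ} (hc : c = 0 ∨ c = Complex.I ∨ c = -Complex.I) :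
    puncturedBall c (1 / 2) ⊆ domain := by
  have key : ∀ z c' : ℂ, z ∈ puncturedBall c (1 / 2) → (c ≠ c' → 1 ≤ ‖c' - c‖) → z ≠ c' := by
    rintro z c' ⟨h1, h2⟩ h3 rfl
    have := h3 h1.symm
    linarith
  intro z hz
  refine ⟨key z _ hz ?_, key z _ hz ?_, key z _ hz ?_⟩ <;> intro h <;>
    rcases hc with rfl | rfl | rfl <;>
    first
    | exact absurd rfl h
    | (rw [norm_two_I]; norm_num)
    | (rw [norm_sub_rev, norm_two_I]; norm_num)
    | simp

lemma outerDomain_subset_domain {r : ℝ} (hr : 1 ≤ r) : outerDomain r ⊆ domain := by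
  intro z hz
  have h : r < ‖z‖ := hz
  have key : ∀ c : ℂ, ‖c‖ ≤ 1 → z ≠ c := by
    rintro c hc rfl
    linarith
  exact ⟨key _ (by simp), key _ (by simp), key _ (by simp)⟩

/-- The target has ends at `0`, `i`, `-i`, `∞`; in the source, three small neighbourhoods of `i`,
`-i`, `∞` already cover the complement of a compact set. -/
lemma not_homeomorphic_domainMS_domain (ψ : domainMS ≃ₜ domain) : False := by
  have hmem : ∀ z : ℂ, z ∈ domain ↔ z ≠ 0 ∧ z ≠ Complex.I ∧ z ≠ -Complex.I := fun _ => Iff.rfl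
  have hmem' : ∀ z : ℂ, z ∈ domainMS ↔ z ≠ Complex.I ∧ z ≠ -Complex.I := fun _ => Iff.rfl
  have hnorm : Continuous fun z : ℂ => ‖z‖ := continuous_norm
  have hnormc : ∀ c : ℂ, Continuous fun z : ℂ => ‖z - c‖ := fun c => by fun_prop
  have hle := card_le_card_of_ends (κ := Fin 3) ψ (fun i => Subtype.val ⁻¹' fourEnds i) ?_ ?_ ?_ ?_ ?_
  · simp at hle
  · intro i
    refine IsOpen.preimage continuous_subtype_val ?_
    fin_cases i
    · exact isOpen_puncturedBall _ _
    · exact isOpen_puncturedBall _ _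
    · exact isOpen_puncturedBall _ _
    · exact isOpen_outerDomain _
  · exact fun i j hij => (pairwise_disjoint_fourEnds hij).preimage _
  · refine isCompact_of_bounds (R := 2) (F := {z | ‖z‖ ≤ 2 ∧ 1 / 2 ≤ ‖z - 0‖ ∧
      1 / 2 ≤ ‖z - Complex.I‖ ∧ 1 / 2 ≤ ‖z - -Complex.I‖}) _ ?_ ?_ (fun z hz => hz.1) ?_
    · exact (isClosed_le hnorm continuous_const).inter
        ((isClosed_le continuous_const (hnormc _)).inter
          ((isClosed_le continuous_const (hnormc _)).inter
            (isClosed_le continuous_const (hnormc _))))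
    · rintro z ⟨-, h1, h2, h3⟩
      refine ⟨?_, ?_, ?_⟩ <;> rintro rfl <;>
        first | (norm_num at h1; done) | (norm_num at h2; done) | norm_num at h3
    · ext ⟨z, hz⟩
      have hz' := (hmem z).1 hz
      simp [fourEnds, Fin.forall_fin_succ, puncturedBall, outerDomain, hz']
      tauto
  · intro i C hC
    fin_cases i
    · exact not_puncturedBall_subset hC (by norm_num) (by simp [hmem])
        (puncturedBall_subset_domain (by simp))
    · exact not_puncturedBall_subset hC (by norm_num) (by simp [hmem])
        (puncturedBall_subset_domain (by simp))
    · exact not_puncturedBall_subset hC (by norm_num) (by simp [hmem])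
        (puncturedBall_subset_domain (by simp))
    · exact not_outerDomain_subset hC two_pos (outerDomain_subset_domain (by norm_num))
  · intro K hK
    obtain ⟨ε₁, hε₁, h1⟩ := exists_forall_le_norm_sub hK (c := Complex.I) (by simp [hmem'])
    obtain ⟨ε₂, hε₂, h2⟩ := exists_forall_le_norm_sub hK (c := -Complex.I) (by simp [hmem'])
    obtain ⟨R, hR, h3⟩ := exists_forall_norm_le hK
    -- The bounds `ε₁`, `ε₂` keep the punctured disks off `K`; the bound `1/2` keeps them inside the
    -- domain.
    set ε := min (min ε₁ ε₂) (1 / 2) with hε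
    have hε0 : 0 < ε := lt_min (lt_min hε₁ hε₂) (by norm_num)
    have hε1 : ε ≤ ε₁ := (min_le_left _ _).trans (min_le_left _ _)
    have hε2 : ε ≤ ε₂ := (min_le_left _ _).trans (min_le_right _ _)
    have hε3 : ε ≤ 1 / 2 := min_le_right _ _
    have hsub : ∀ c, (c = 0 ∨ c = Complex.I ∨ c = -Complex.I) → puncturedBall c ε ⊆ domainMS :=
      fun c hc z hz => (puncturedBall_subset_domain hc ⟨hz.1, hz.2.trans_le hε3⟩).2
    have hsub' : outerDomain (max R 1) ⊆ domainMS :=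
      fun z hz => (outerDomain_subset_domain (le_max_right R 1) hz).2
    refine ⟨fun j => Subtype.val ⁻¹' (![puncturedBall Complex.I ε, puncturedBall (-Complex.I) ε,
      outerDomain (max R 1)] j : Set ℂ), ?_, ?_, ?_⟩
    · intro j
      fin_cases j
      · exact isPreconnected_preimage_val (isPreconnected_puncturedBall _ hε0) (hsub _ (by simp))
      · exact isPreconnected_preimage_val (isPreconnected_puncturedBall _ hε0) (hsub _ (by simp))
      · exact isPreconnected_preimage_val (isPreconnected_outerDomain (by positivity)) hsub'
    · intro j
      rw [Set.disjoint_left]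
      intro z hz hzK
      fin_cases j
      · exact absurd (h1 z hzK) (not_le.2 (hz.2.trans_le hε1))
      · exact absurd (h2 z hzK) (not_le.2 (hz.2.trans_le hε2))
      · exact absurd (h3 z hzK) (not_le.2 ((le_max_left R 1).trans_lt hz))
    · refine isCompact_of_bounds (R := max R 1) (F := {z | ‖z‖ ≤ max R 1 ∧
        ε ≤ ‖z - Complex.I‖ ∧ ε ≤ ‖z - -Complex.I‖}) _ ?_ ?_ (fun z hz => hz.1) ?_
      · exact (isClosed_le hnorm continuous_const).inter
          ((isClosed_le continuous_const (hnormc _)).inter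
            (isClosed_le continuous_const (hnormc _)))
      · rintro z ⟨-, h1, h2⟩
        refine ⟨?_, ?_⟩ <;> rintro rfl <;> simp at h1 h2 <;> linarith
      · ext ⟨z, hz⟩
        have hz' := (hmem' z).1 hz
        simp [Fin.forall_fin_succ, puncturedBall, outerDomain, hz', -sup_lt_iff]
        tauto

end MinimalSurface
end

theorem theorem3 (a b : ℝ) (σ : ℂ) (ha : a ≠ 1) (hb : b ≠ 1) (hab : a ≠ b)
    (hneg : sigmaSq a b < 0) (hσ : σ ^ 2 = ((sigmaSq a b : ℝ) : ℂ)) :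
    ∃ X : ℂ → E3,
      -- a minimal surface with the given Weierstrass data, unique up to translation
      IsMinimalSurface X domain ∧
      HasWeierstrassData X domain (gData a b σ) (hData a b) ∧
      (∀ X' : ℂ → E3, IsMinimalSurface X' domain →
        HasWeierstrassData X' domain (gData a b σ) (hData a b) →
        ∃ c : E3, ∀ z ∈ domain, X' z = X z + c) ∧
      -- complete, of finite total curvature
      IsCompleteSurface X domain ∧
      HasFiniteTotalCurvature X domain ∧
      totalCurvature X domain = -(16 * Real.pi) ∧
      -- the Gauss map of the surface is `g`
      (∀ z ∈ domain, TakesValueAt (gData a b σ) (gaussMap X z) z) ∧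
      -- two omitted values, one totally ramified value of order two, and total weight `5/2`
      omittedValues (gData a b σ) domain =
        {((σ : ℂ) : OnePoint ℂ), ((σ * a : ℂ) : OnePoint ℂ)} ∧
      (omittedValues (gData a b σ) domain).encard = 2 ∧
      ramificationOrder (gData a b σ) domain ((σ * b : ℂ) : OnePoint ℂ) = 2 ∧
      totallyRamifiedValues (gData a b σ) domain \ omittedValues (gData a b σ) domain =
        {((σ * b : ℂ) : OnePoint ℂ)} ∧
      totalWeight (gData a b σ) domain = 5 / 2 ∧
      -- not one of the Miyaoka–Sato surfaces
      (∀ Y : ℂ → E3, IsMiyaokaSato Y → ¬ AreSimilar X domain Y domainMS) := by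
  have hσ0 : σ ≠ 0 := by
    rintro rfl
    rw [zero_pow two_ne_zero] at hσ
    exact hneg.ne (by exact_mod_cast hσ.symm)
  have hX := isSpinorSurface_surface ha hb hneg hσ
  have hK := totalCurvature_surface ha hb hab hneg hσ
  refine ⟨surface a b σ, hX.isMinimalSurface,
    hasWeierstrassData_of_isSpinorSurface ha hb hab hσ0 hX,
    fun X' hm hw => unique_up_to_translation hab hX hm hw,
    isComplete_surface ha hb hab hneg hσ, hK.1, hK.2,
    fun z hz => takesValueAt_gaussMap ha hb hab hσ0 hX hz,
    omittedValues_gData ha hb hab hσ0, ?_, ramificationOrder_sigma_mul_b ha hb hab hσ0,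
    totallyRamifiedValues_diff ha hb hab hσ0, totalWeight_gData ha hb hab hσ0, ?_⟩
  · rw [omittedValues_gData ha hb hab hσ0]
    exact Set.encard_pair (sigma_ne_sigma_mul ha hσ0)
  -- The obstruction is purely topological: four ends against three.
  · rintro Y - ⟨ψ, -⟩
    exact not_homeomorphic_domainMS_domain ψ
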